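/- Let $k$ be an algebraically closed field of characteristic zero, let $\mathcal{O}(M_3)=k[x_{ij}: 1\le i,j\le 3]$, $Det=\det(x_{ij})$ and $\mathcal{O}(GL_3)=\mathcal{O}(M_3)[Det^{-1}]$, with the Poisson bracket determined by $$\{x_{ij},x_{im}\}=x_{ij}x_{im}\ (j<m),\quad \{x_{ij},x_{lj}\}=x_{ij}x_{lj}\ (i<l),\quad \{x_{im},x_{lj}\}=0,\quad \{x_{ij},x_{lm}\}=2x_{im}x_{lj}\ (i<l,\ j<m).$$ The torus $\mathcal{H}=(k^\times)^6$ acts on $\mathcal{O}(GL_3)$ by $(\alpha_1,\alpha_2,\alpha_3,\beta_1,\beta_2,\beta_3).x_{ij}=\alpha_i\beta_jx_{ij}$. An ideal $I$ is a Poisson ideal if $\{I,\mathcal{O}(GL_3)\}\subseteq I$, and it is $\mathcal{H}$-stable if $h(I)=I$ for all $h\in\mathcal{H}$. A Poisson $\mathcal{H}$-prime is a proper $\mathcal{H}$-stable Poisson ideal $P$ such that, for all $\mathcal{H}$-stable Poisson ideals $J,K$ with $JK\subseteq P$, one has $J\subseteq P$ or $K\subseteq P$. For $\omega=(\omega_+,\omega_-)\in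 S_3\times S_3$ let $I_\omega$ be the ideal of $\mathcal{O}(GL_3)$ generated by $L(\omega_+)\cup U(\omega_-)$, where, with permutations in one-line notation (so that $231$ is $1\mapsto2$, $2\mapsto3$, $3\mapsto1$), $$\begin{array}{c|cccccc} w & 321 & 231 & 312 & 132 & 213 & 123\\ \hline U(w) & \emptyset & \{x_{12}x_{23}-x_{13}x_{22}\} & \{x_{13}\} & \{x_{12},x_{13}\} & \{x_{13},x_{23}\} & \{x_{12},x_{13},x_{23}\}\\ L(w) & \emptyset & \{x_{31}\} & \{x_{21}x_{32}-x_{22}x_{31}\} & \{x_{21},x_{31}\} & \{x_{31},x_{32}\} & \{x_{21},x_{31},x_{32}\}\end{array}$$ Then $\mathcal{O}(GL_3)$ has exactly 36 Poisson $\mathcal{H}$-primes, and these are the ideals $I_\omega$, $\omega\in S_3\times S_3$. Moreover each $I_\omega$ is a prime ideal in the usual commutative sense, so the $I_\omega$ are also exactly the $\mathcal{H}$-stable Poisson ideals of $\mathcal{O}(GL_3)$ that are prime. -/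

import Mathlib

open MvPolynomial

noncomputable section

/-! ## Poisson algebras, Poisson ideals, Poisson `H`-primes -/

/-- A (commutative) Poisson algebra over `k`: a bilinear Lie bracket which is a derivation in each
variable. -/
class PoissonAlgebra (k R : Type*) [CommRing k] [CommRing R] [Algebra k R] where
  /-- the Poisson bracket `{a, b}` -/
  bracket : R →ₗ[k] R →ₗ[k] R
  bracket_self : ∀ a, bracket a a = 0
  jacobi : ∀ a b c,
    bracket a (bracket b c) + bracket b (bracket c a) + bracket c (bracket a b) = 0
  leibniz : ∀ a b c, bracket a (b * c) = bracket a b * c + b * bracket a c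

/-- An ideal `I` of a Poisson algebra `R` is a Poisson ideal if `{I, R} ⊆ I`. -/
def IsPoissonIdeal (k : Type*) {R : Type*} [CommRing k] [CommRing R] [Algebra k R]
    [PoissonAlgebra k R] (I : Ideal R) : Prop :=
  ∀ a ∈ I, ∀ b : R, PoissonAlgebra.bracket (k := k) a b ∈ I

/-- `I` is stable under the action `ρ` of the group `H`: `h(I) = I` for all `h ∈ H`. -/
def IsHStable {k R H : Type*} [CommRing k] [CommRing R] [Algebra k R] [Group H]
    (ρ : H →* (R ≃ₐ[k] R)) (I : Ideal R) : Prop :=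
  ∀ h : H, I.map (ρ h) = I

/-- Poisson `H`-primes: proper `H`-stable Poisson ideals `P` such that `J * K ⊆ P` implies
`J ⊆ P` or `K ⊆ P` for all `H`-stable Poisson ideals `J`, `K`. -/
structure IsPoissonHPrime {k R H : Type*} [CommRing k] [CommRing R] [Algebra k R]
    [PoissonAlgebra k R] [Group H] (ρ : H →* (R ≃ₐ[k] R)) (P : Ideal R) : Prop where
  ne_top : P ≠ ⊤
  poisson : IsPoissonIdeal k P
  stable : IsHStable ρ P
  le_or_le : ∀ J K : Ideal R, IsPoissonIdeal k J → IsHStable ρ J → IsPoissonIdeal k K →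
    IsHStable ρ K → J * K ≤ P → J ≤ P ∨ K ≤ P

/-! ## The coordinate rings of `3 × 3` matrices and of `GL₃` -/

/-- `O(M₃) = k[x_ij]`. -/
abbrev OM3 (k : Type*) [Field k] : Type _ := MvPolynomial (Fin 3 × Fin 3) k

/-- The determinant of the generic `3 × 3` matrix. -/
def genericDet (k : Type*) [Field k] : OM3 k := (Matrix.mvPolynomialX (Fin 3) (Fin 3) k).det

/-- `O(GL₃) = O(M₃)[Det⁻¹]`. -/
abbrev OGL3 (k : Type*) [Field k] : Type _ := Localization.Away (genericDet k)

/-- The matrix of coordinate functions `x_ij ∈ O(GL₃)` (rows and columns numbered `0, 1, 2`). -/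
def coordMat (k : Type*) [Field k] : Matrix (Fin 3) (Fin 3) (OGL3 k) :=
  Matrix.of fun i j => algebraMap (OM3 k) (OGL3 k) (X (i, j))

/-- The complementary `2 × 2` minor: delete row `i` and column `j`. -/
def complMinor (k : Type*) [Field k] (i j : Fin 3) : OGL3 k :=
  ((coordMat k).submatrix i.succAbove j.succAbove).det

/-! ## The standard Poisson bracket on `O(GL₃)` -/

/-- The unique extension of a derivation on `A` to a localization `B` of `A`. -/
def extendDerivation (k : Type*) {A : Type*} [CommRing k] [CommRing A] [Algebra k A]
    (S : Submonoid A) {M : Type*} [AddCommGroup M] [Module k M] [Module A M]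
    [Module (Localization S) M] [IsScalarTower k A M] [IsScalarTower k (Localization S) M]
    [IsScalarTower A (Localization S) M]
    (d : Derivation k A M) : Derivation k (Localization S) M :=
  haveI : Algebra.FormallyEtale A (Localization S) := .of_isLocalization S
  ((d.liftKaehlerDifferential.liftBaseChange (Localization S)) ∘ₗ
    (KaehlerDifferential.tensorKaehlerEquivOfFormallyEtale k A
      (Localization S)).symm.toLinearMap).compDer (KaehlerDifferential.D k (Localization S))

theorem extendDerivation_algebraMap (k : Type*) {A : Type*} [CommRing k] [CommRing A] [Algebra k A]
    (S : Submonoid A) {M : Type*} [AddCommGroup M] [Module k M] [Module A M]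
    [Module (Localization S) M] [IsScalarTower k A M] [IsScalarTower k (Localization S) M]
    [IsScalarTower A (Localization S) M]
    (d : Derivation k A M) (a : A) :
    extendDerivation k S d (algebraMap A (Localization S) a) = d a := by
  have : Algebra.FormallyEtale A (Localization S) := .of_isLocalization S
  simp [extendDerivation,
    KaehlerDifferential.tensorKaehlerEquivOfFormallyEtale_symm_D_algebraMap]

/-- Sign of `j - i`. -/
def ordSign (i j : Fin 3) : ℤ := if i < j then 1 else if j < i then -1 else 0

/-- The values `{x_ij, x_lm}` of the standard bracket on the generators: for `i < l` and `j < m`,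
`{x_ij, x_im} = x_ij x_im`, `{x_im, x_lm} = x_im x_lm`, `{x_im, x_lj} = 0` and
`{x_ij, x_lm} = 2 x_im x_lj`. -/
def bracketGen (k : Type*) [Field k] (a b : Fin 3 × Fin 3) : OGL3 k :=
  (ordSign a.1 b.1 + ordSign a.2 b.2) • (coordMat k a.1 b.2 * coordMat k b.1 a.2)

/-- The standard Poisson bracket on `O(GL₃)` as a biderivation: the unique one with values
`bracketGen` on the generators. -/
def bracketDer (k : Type*) [Field k] : Derivation k (OGL3 k) (Derivation k (OGL3 k) (OGL3 k)) :=
  extendDerivation k (Submonoid.powers (genericDet k)) <|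
    mkDerivation k fun a => extendDerivation k (Submonoid.powers (genericDet k)) <|
      mkDerivation k fun b => bracketGen k a b

theorem bracketDer_coord (k : Type*) [Field k] (a b : Fin 3 × Fin 3) :
    bracketDer k (coordMat k a.1 a.2) (coordMat k b.1 b.2) = bracketGen k a b := by
  simp only [bracketDer, coordMat, Matrix.of_apply, extendDerivation_algebraMap, mkDerivation_X]

/-- Two derivations of `O(GL₃)` that agree on the coordinate functions are equal. -/
theorem derivation_ext_coord (k : Type*) [Field k] {M : Type*} [AddCommGroup M] [Module k M]
    [Module (OGL3 k) M] {d e : Derivation k (OGL3 k) M}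
    (h : ∀ a : Fin 3 × Fin 3, d (coordMat k a.1 a.2) = e (coordMat k a.1 a.2)) : d = e := by
  suffices H : ∀ f : OM3 k, (d - e) (algebraMap (OM3 k) (OGL3 k) f) = 0 by
    rw [← sub_eq_zero]
    ext x
    obtain ⟨f, s, rfl⟩ := IsLocalization.exists_mk'_eq (Submonoid.powers (genericDet k)) x
    have hs : IsUnit (algebraMap (OM3 k) (OGL3 k) s) := IsLocalization.map_units _ s
    have h1 := congrArg (d - e) (IsLocalization.mk'_spec (OGL3 k) f s)
    rw [Derivation.leibniz, H, H, smul_zero, zero_add] at h1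
    simpa using hs.smul_eq_zero.mp h1
  intro f
  induction f using MvPolynomial.induction_on with
  | C a =>
    rw [← MvPolynomial.algebraMap_eq, ← IsScalarTower.algebraMap_apply]
    exact Derivation.map_algebraMap _ a
  | add p q hp hq => rw [map_add, map_add, hp, hq, add_zero]
  | mul_X p a hp =>
    have h2 : (d - e) (algebraMap (OM3 k) (OGL3 k) (X a)) = 0 := by
      have := h a
      simp only [coordMat, Matrix.of_apply] at this
      rw [Derivation.sub_apply, this, sub_self]
    rw [map_mul, Derivation.leibniz, hp, h2, smul_zero, smul_zero, add_zero]

/-- For fixed `w`, the derivation `u ↦ {u, w}`. -/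
def bracketDerFlip (k : Type*) [Field k] (w : OGL3 k) : Derivation k (OGL3 k) (OGL3 k) :=
  LinearMap.compDer
    ({ toFun := fun d => d w
       map_add' := fun _ _ => rfl
       map_smul' := fun _ _ => rfl } : Derivation k (OGL3 k) (OGL3 k) →ₗ[OGL3 k] OGL3 k)
    (bracketDer k)

theorem bracketDerFlip_apply (k : Type*) [Field k] (u w : OGL3 k) :
    bracketDerFlip k w u = bracketDer k u w := rfl

theorem bracketGen_skew (k : Type*) [Field k] (a b : Fin 3 × Fin 3) :
    bracketGen k a b = -bracketGen k b a := by
  have h : ∀ i j : Fin 3, ordSign i j = -ordSign j i := by decide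
  rw [bracketGen, bracketGen, h a.1, h a.2, ← neg_add, neg_smul, mul_comm (coordMat k a.1 b.2)]

theorem bracketDer_skew (k : Type*) [Field k] (u v : OGL3 k) :
    bracketDer k u v = -bracketDer k v u := by
  have h1 (b : Fin 3 × Fin 3) (u : OGL3 k) : bracketDer k u (coordMat k b.1 b.2) =
      -bracketDer k (coordMat k b.1 b.2) u := by
    have : bracketDerFlip k (coordMat k b.1 b.2) = -bracketDer k (coordMat k b.1 b.2) := by
      refine derivation_ext_coord k fun a => ?_
      rw [bracketDerFlip_apply, Derivation.neg_apply, bracketDer_coord, bracketDer_coord,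
        bracketGen_skew]
    exact congrArg (fun d => d u) this
  have : bracketDer k u = -bracketDerFlip k u := by
    refine derivation_ext_coord k fun b => ?_
    rw [Derivation.neg_apply, bracketDerFlip_apply, h1]
  exact congrArg (fun d => d v) this

/-- The cyclic sum `{u, {v, w}} + {v, {w, u}} + {w, {u, v}}`. -/
def jacobiator (k : Type*) [Field k] (u v w : OGL3 k) : OGL3 k :=
  bracketDer k u (bracketDer k v w) + bracketDer k v (bracketDer k w u) +
    bracketDer k w (bracketDer k u v)

theorem jacobiator_cycle (k : Type*) [Field k] (u v w : OGL3 k) :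
    jacobiator k u v w = jacobiator k v w u := by
  simp only [jacobiator]; ring

theorem jacobiator_eq (k : Type*) [Field k] (u v w : OGL3 k) :
    jacobiator k u v w =
      (⁅bracketDer k u, bracketDer k v⁆ - bracketDer k (bracketDer k u v)) w := by
  rw [jacobiator, Derivation.sub_apply, Derivation.commutator_apply,
    bracketDer_skew k w (bracketDer k u v), bracketDer_skew k w u, map_neg]
  ring

theorem jacobiator_eq_zero_of_coord (k : Type*) [Field k] (u v : OGL3 k)
    (h : ∀ a : Fin 3 × Fin 3, jacobiator k u v (coordMat k a.1 a.2) = 0) (w : OGL3 k) :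
    jacobiator k u v w = 0 := by
  have : ⁅bracketDer k u, bracketDer k v⁆ - bracketDer k (bracketDer k u v) = 0 :=
    derivation_ext_coord k fun a => by rw [← jacobiator_eq, h, Derivation.zero_apply]
  rw [jacobiator_eq, this, Derivation.zero_apply]

theorem jacobiator_coord (k : Type*) [Field k] (a b c : Fin 3 × Fin 3) :
    jacobiator k (coordMat k a.1 a.2) (coordMat k b.1 b.2) (coordMat k c.1 c.2) = 0 := by
  have key (a b c : Fin 3 × Fin 3) :
      bracketDer k (coordMat k a.1 a.2) (bracketDer k (coordMat k b.1 b.2) (coordMat k c.1 c.2)) =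
      (ordSign b.1 c.1 + ordSign b.2 c.2) •
        ((ordSign a.1 c.1 + ordSign a.2 b.2) •
            (coordMat k a.1 b.2 * coordMat k b.1 c.2 * coordMat k c.1 a.2) +
          (ordSign a.1 b.1 + ordSign a.2 c.2) •
            (coordMat k a.1 c.2 * coordMat k b.1 a.2 * coordMat k c.1 b.2)) := by
    have e1 := bracketDer_coord k a (b.1, c.2)
    have e2 := bracketDer_coord k a (c.1, b.2)
    simp only at e1 e2
    rw [bracketDer_coord k b c, bracketGen, map_zsmul, Derivation.leibniz, e1, e2, bracketGen,
      bracketGen]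
    simp only [smul_eq_mul, zsmul_eq_mul]
    ring
  obtain ⟨i, j⟩ := a
  obtain ⟨l, m⟩ := b
  obtain ⟨p, q⟩ := c
  have hc : ∀ i j l m p q : Fin 3, ∃ z : ℤ,
      (ordSign l p + ordSign m q) * (ordSign i p + ordSign j m) +
        (ordSign p i + ordSign q j) * (ordSign l i + ordSign m q) +
        (ordSign i l + ordSign j m) * (ordSign p l + ordSign q j) = z ∧
      (ordSign l p + ordSign m q) * (ordSign i l + ordSign j q) +
        (ordSign p i + ordSign q j) * (ordSign l p + ordSign m j) +
        (ordSign i l + ordSign j m) * (ordSign p i + ordSign q m) = -z ∧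
      (z = 0 ∨ (i = l ∧ l = p) ∨ (j = m ∧ m = q)) := by
    simp only [exists_eq_left']
    decide +revert
  obtain ⟨z, h1, h2, h3⟩ := hc i j l m p q
  have hJ : jacobiator k (coordMat k i j) (coordMat k l m) (coordMat k p q) =
      (z : OGL3 k) * (coordMat k i m * coordMat k l q * coordMat k p j -
        coordMat k i q * coordMat k l j * coordMat k p m) := by
    have e1 := key (i, j) (l, m) (p, q)
    have e2 := key (l, m) (p, q) (i, j)
    have e3 := key (p, q) (i, j) (l, m)
    have h1' := congrArg (Int.cast : ℤ → OGL3 k) h1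
    have h2' := congrArg (Int.cast : ℤ → OGL3 k) h2
    simp only [zsmul_eq_mul] at e1 e2 e3
    push_cast at e1 e2 e3 h1' h2'
    rw [jacobiator, e1, e2, e3]
    linear_combination (coordMat k i m * coordMat k l q * coordMat k p j) * h1' +
      (coordMat k i q * coordMat k l j * coordMat k p m) * h2'
  rw [hJ]
  rcases h3 with rfl | ⟨rfl, rfl⟩ | ⟨rfl, rfl⟩
  · simp
  · ring
  · ring

/-- `O(GL₃)` with the standard bracket is a Poisson algebra. -/
instance instPoissonOGL3 (k : Type*) [Field k] [CharZero k] :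
    PoissonAlgebra k (OGL3 k) where
  bracket := LinearMap.mk₂ k (fun u v => bracketDer k u v) (by simp) (by simp) (by simp) (by simp)
  bracket_self u := by
    have h : (2 : k) • bracketDer k u u = 0 := by
      rw [two_smul]; nth_rewrite 1 [bracketDer_skew]; exact neg_add_cancel _
    exact (smul_eq_zero.mp h).resolve_left two_ne_zero
  jacobi u v w := by
    change jacobiator k u v w = 0
    refine jacobiator_eq_zero_of_coord k u v (fun a => ?_) w
    rw [jacobiator_cycle, jacobiator_cycle]
    refine jacobiator_eq_zero_of_coord k _ _ (fun b => ?_) v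
    rw [jacobiator_cycle, jacobiator_cycle]
    exact jacobiator_eq_zero_of_coord k _ _ (fun c => jacobiator_coord k b a c) u
  leibniz u v w := by
    simp only [LinearMap.mk₂_apply, Derivation.leibniz, smul_eq_mul]
    ring

/-! ## The action of the torus `(kˣ)⁶` on `O(GL₃)` -/

/-- The torus `H = (kˣ)⁶`, with elements `h = (α, β) = (α₁, α₂, α₃, β₁, β₂, β₃)`. -/
abbrev Torus (k : Type*) [Field k] : Type _ := (Fin 3 → kˣ) × (Fin 3 → kˣ)

/-- The endomorphism `x_ij ↦ α_i β_j x_ij` of `O(M₃)`. -/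
def torusM3 (k : Type*) [Field k] (h : Torus k) : OM3 k →ₐ[k] OM3 k :=
  aeval fun a => ((h.1 a.1 : k) * (h.2 a.2 : k)) • X a

theorem torusM3_det (k : Type*) [Field k] (h : Torus k) :
    torusM3 k h (genericDet k) = ((∏ i, (h.1 i : k)) * ∏ j, (h.2 j : k)) • genericDet k := by
  simp only [genericDet, Matrix.det_fin_three, Matrix.mvPolynomialX_apply, map_sub, map_add,
    map_mul, torusM3, aeval_X, Fin.prod_univ_three, smul_eq_C_mul]
  ring

theorem torusM3_det_isUnit (k : Type*) [Field k] (h : Torus k) :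
    IsUnit (((IsScalarTower.toAlgHom k (OM3 k) (OGL3 k)).comp (torusM3 k h)) (genericDet k)) := by
  have hu : IsUnit (algebraMap (OM3 k) (OGL3 k) (genericDet k)) :=
    IsLocalization.Away.algebraMap_isUnit _
  have hc : IsUnit (algebraMap k (OGL3 k) ((∏ i, (h.1 i : k)) * ∏ j, (h.2 j : k))) :=
    (isUnit_iff_ne_zero.mpr (mul_ne_zero (Finset.prod_ne_zero_iff.mpr fun i _ => (h.1 i).ne_zero)
      (Finset.prod_ne_zero_iff.mpr fun i _ => (h.2 i).ne_zero))).map _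
  rw [AlgHom.comp_apply, torusM3_det, map_smul, Algebra.smul_def]
  exact hc.mul hu

/-- The endomorphism of `O(GL₃)` given by `h.x_ij = α_i β_j x_ij`. -/
def torusEnd (k : Type*) [Field k] (h : Torus k) : OGL3 k →ₐ[k] OGL3 k :=
  IsLocalization.Away.liftAlgHom (genericDet k) (torusM3_det_isUnit k h)

theorem torusEnd_coord (k : Type*) [Field k] (h : Torus k) (i j : Fin 3) :
    torusEnd k h (coordMat k i j) = ((h.1 i : k) * (h.2 j : k)) • coordMat k i j := by
  have e : torusEnd k h (coordMat k i j) =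
      IsScalarTower.toAlgHom k (OM3 k) (OGL3 k) (torusM3 k h (X (i, j))) :=
    IsLocalization.Away.lift_eq (genericDet k) (torusM3_det_isUnit k h) _
  rw [e, torusM3, aeval_X, map_smul]
  rfl

/-- Algebra endomorphisms of `O(GL₃)` that agree on the coordinate functions are equal. -/
theorem algHom_ext_coord (k : Type*) [Field k] {f g : OGL3 k →ₐ[k] OGL3 k}
    (h : ∀ i j, f (coordMat k i j) = g (coordMat k i j)) : f = g := by
  refine IsLocalization.algHom_ext (W := Submonoid.powers (genericDet k)) (A := OM3 k) ?_
  refine MvPolynomial.algHom_ext fun a => ?_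
  exact h a.1 a.2

theorem torusEnd_one (k : Type*) [Field k] : torusEnd k 1 = AlgHom.id k (OGL3 k) :=
  algHom_ext_coord k fun i j => by simp [torusEnd_coord]

theorem torusEnd_mul (k : Type*) [Field k] (g h : Torus k) :
    torusEnd k (g * h) = (torusEnd k g).comp (torusEnd k h) :=
  algHom_ext_coord k fun i j => by
    simp only [torusEnd_coord, AlgHom.comp_apply, map_smul, smul_smul, Prod.fst_mul, Prod.snd_mul,
      Pi.mul_apply, Units.val_mul]
    congr 1; ring

/-- The action of the torus `H = (kˣ)⁶` on `O(GL₃)` by algebra automorphisms,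
`(α, β).x_ij = α_i β_j x_ij`. -/
def torusAction (k : Type*) [Field k] : Torus k →* (OGL3 k ≃ₐ[k] OGL3 k) where
  toFun h := AlgEquiv.ofAlgHom (torusEnd k h) (torusEnd k h⁻¹)
    (by rw [← torusEnd_mul, mul_inv_cancel, torusEnd_one])
    (by rw [← torusEnd_mul, inv_mul_cancel, torusEnd_one])
  map_one' := by ext x; exact congrArg (fun f => f x) (torusEnd_one k)
  map_mul' g h := by ext x; exact congrArg (fun f => f x) (torusEnd_mul k g h)

/-! ## The 36 ideals -/

/-- The generators of `I_ω` above the diagonal, as a function of the permutation `w = ω₋`, which is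
given by its one-line notation (with `0, 1, 2` in place of `1, 2, 3`). -/
def upperGens (k : Type*) [Field k] (w : Equiv.Perm (Fin 3)) : Set (OGL3 k) :=
  match w 0, w 1, w 2 with
  | 2, 1, 0 => ∅
  | 1, 2, 0 => {complMinor k 2 0}
  | 2, 0, 1 => {coordMat k 0 2}
  | 0, 2, 1 => {coordMat k 0 1, coordMat k 0 2}
  | 1, 0, 2 => {coordMat k 0 2, coordMat k 1 2}
  -- the identity permutation
  | _, _, _ => {coordMat k 0 1, coordMat k 0 2, coordMat k 1 2}

/-- The generators of `I_ω` below the diagonal, as a function of the permutation `w = ω₊`. -/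
def lowerGens (k : Type*) [Field k] (w : Equiv.Perm (Fin 3)) : Set (OGL3 k) :=
  match w 0, w 1, w 2 with
  | 2, 1, 0 => ∅
  | 1, 2, 0 => {coordMat k 2 0}
  | 2, 0, 1 => {complMinor k 0 2}
  | 0, 2, 1 => {coordMat k 1 0, coordMat k 2 0}
  | 1, 0, 2 => {coordMat k 2 0, coordMat k 2 1}
  -- the identity permutation
  | _, _, _ => {coordMat k 1 0, coordMat k 2 0, coordMat k 2 1}

/-- The ideal `I_ω` of `O(GL₃)`, for `ω = (ω₊, ω₋) ∈ S₃ × S₃`. -/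
def idealI (k : Type*) [Field k] (ω : Equiv.Perm (Fin 3) × Equiv.Perm (Fin 3)) : Ideal (OGL3 k) :=
  Ideal.span (lowerGens k ω.1 ∪ upperGens k ω.2)

end

noncomputable section

/-! ## Minimal primes over stable ideals -/

/-! A Poisson `H`-prime P is an ordinary prime. There are finitely many minimal primes over P; they
are Poisson because the characteristic is zero, and torus-stable because a divisible group acts
trivially on a finite set. A power of their product lies in P, so P is one of them
(`IsPoissonHPrime.isPrime`).

Let Δ be the leading 2×2 minor. For c = x00 or c = Δ, every ideal containing c and all brackets {c,
·} contains a power of the unit det. Hence c lies in no proper Poisson ideal and, by a Noetherian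
argument, is regular modulo every Poisson ideal (`IsPoissonIdeal.mem_of_mul_mem`). Once x00, Δ and
det may be inverted, the Gauss decomposition parametrises each stratum: I_ω is the kernel of
evaluation at a generic point over a rational function field, so it is prime
(`isPrime_stratumIdeal`).

Conversely, let P be a Poisson `H`-prime. Relations such as {x01, x_i2} = 2 x02 x_i1 (i > 0),
together with det ∉ P, force P to contain one of six generating sets above the diagonal and to avoid
a matching list of cluster variables; transposition gives the same below (`exists_upper`,
`exists_lower`). Thus some I_ω ≤ P. Modulo I_ω every element is a fraction in the avoided variables,
so P ≤ I_ω follows once their monomials are linearly independent modulo P. These monomials are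
common eigenvectors, up to factors outside P, of the torus and of the brackets with a few cluster
variables. Their joint characters are distinct, and Dedekind's argument applies
(`eq_zero_of_clusterMonomial_sum_mem`).

The 36 ideals are told apart by one explicit point on each stratum (`eq_of_stratumIdeal_le`). -/

theorem Ideal.exists_mul_pow_mem_of_mem_minimalPrimes {R : Type*} [CommRing R] {I Q : Ideal R}
    (hQ : Q ∈ I.minimalPrimes) {a : R} (ha : a ∈ Q) : ∃ s ∉ Q, ∃ n : ℕ, s * a ^ n ∈ I := by
  have hp : Q.IsPrime := hQ.1.1
  by_contra! hcon
  -- If no `s * a ^ n` lies in `I`, this multiplicative set misses `I`. A prime over `I` disjoint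
  -- from it lies in `Q` and omits `a`, against minimality.
  let S : Submonoid R := Q.primeCompl ⊔ Submonoid.powers a
  have hdis : Disjoint (I : Set R) S := by
    rw [Set.disjoint_left]
    rintro x hx hxS
    obtain ⟨s, hs, t, ⟨n, rfl⟩, rfl⟩ := Submonoid.mem_sup.mp hxS
    exact hcon s hs n hx
  obtain ⟨p, hp1, hp2, hp3⟩ := Ideal.exists_le_prime_disjoint I S hdis
  have hpQ : p ≤ Q := fun x hx => by
    by_contra hxQ
    exact Set.disjoint_left.mp hp3 hx (Submonoid.mem_sup_left (S := Q.primeCompl) hxQ)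
  exact Set.disjoint_left.mp hp3 (hQ.2 ⟨hp1, hp2⟩ hpQ ha)
    (Submonoid.mem_sup_right (Submonoid.mem_powers a))

/-- In characteristic zero, the minimal primes over an ideal stable under a derivation are stable
under it. -/
theorem Derivation.map_mem_of_mem_minimalPrimes {k R : Type*} [Field k] [CharZero k] [CommRing R]
    [Algebra k R] (δ : Derivation k R R) {I Q : Ideal R} (hI : ∀ a ∈ I, δ a ∈ I)
    (hQ : Q ∈ I.minimalPrimes) {a : R} (ha : a ∈ Q) : δ a ∈ Q := by
  have hp : Q.IsPrime := hQ.1.1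
  -- Descent on the power of `a`: apply `δ` to `t * a ^ (n + 1) * δ a ^ e`, multiply by `t * δ a`,
  -- and remove the terms still divisible by the original element. What remains is `n + 1` times `t
  -- ^ 2 * a ^ n * δ a ^ (e + 2)`.
  have key : ∀ n : ℕ, (∃ t ∉ Q, ∃ e : ℕ, t * a ^ n * δ a ^ e ∈ I) → δ a ∈ Q := by
    intro n
    induction n with
    | zero =>
      rintro ⟨t, ht, e, h⟩
      rw [pow_zero, mul_one] at h
      exact hp.mem_of_pow_mem _ ((hp.mem_or_mem (hQ.1.2 h)).resolve_left ht)
    | succ n ih =>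
      rintro ⟨t, ht, e, h⟩
      refine ih ⟨t * t, fun h' => (hp.mem_or_mem h').elim ht ht, e + 2, ?_⟩
      have h1 := I.mul_mem_left (t * δ a) (hI _ h)
      have h2 := I.mul_mem_left (δ t * δ a + t * e * δ (δ a)) h
      have h3 : ((n + 1 : ℕ) : R) * (t * t * a ^ n * δ a ^ (e + 2)) ∈ I := by
        have h4 := I.sub_mem h1 h2
        convert h4 using 1
        simp only [Derivation.leibniz, Derivation.leibniz_pow, smul_eq_mul, nsmul_eq_mul,
          Nat.add_sub_cancel]
        -- The derivative of `δ a ^ e` carries the truncated exponent `e - 1`, so `e = 0` is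
        -- separate.
        rcases e with _ | e
        · simp; ring
        · simp only [Nat.add_sub_cancel]; push_cast; ring
      have h5 := I.mul_mem_left (algebraMap k R ((n + 1 : ℕ) : k)⁻¹) h3
      rwa [← mul_assoc, ← _root_.map_natCast (algebraMap k R), ← _root_.map_mul,
        inv_mul_cancel₀ (Nat.cast_ne_zero.mpr n.succ_ne_zero), map_one, one_mul] at h5
  obtain ⟨s, hs, n, h⟩ := Ideal.exists_mul_pow_mem_of_mem_minimalPrimes hQ ha
  exact key n ⟨s, hs, 0, by simpa using h⟩

/-! ### Ideals stable under a group action -/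

section Stable

variable {k R H : Type*} [Field k] [CommRing R] [Algebra k R] [Group H]
  {ρ : H →* (R ≃ₐ[k] R)}

theorem isHStable_iff {I : Ideal R} : IsHStable ρ I ↔ ∀ h, ∀ a ∈ I, ρ h a ∈ I := by
  constructor
  · intro hI h a ha
    rw [← hI h]
    exact Ideal.mem_map_of_mem _ ha
  · intro hI h
    refine le_antisymm (Ideal.map_le_iff_le_comap.mpr fun a ha => hI h a ha) fun a ha => ?_
    have h1 := Ideal.mem_map_of_mem (ρ h) (hI h⁻¹ a ha)
    rwa [← AlgEquiv.mul_apply, ← map_mul, mul_inv_cancel, map_one] at h1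

theorem IsHStable.mul {I J : Ideal R} (hI : IsHStable ρ I) (hJ : IsHStable ρ J) :
    IsHStable ρ (I * J) := fun h => by
  rw [Ideal.map_mul, hI h, hJ h]

theorem IsHStable.top : IsHStable ρ (⊤ : Ideal R) := fun _ => Ideal.map_top _

theorem IsHStable.sup {I J : Ideal R} (hI : IsHStable ρ I) (hJ : IsHStable ρ J) :
    IsHStable ρ (I ⊔ J) := fun h => by
  rw [Ideal.map_sup, hI h, hJ h]

/-- A divisible group permutes the finitely many minimal primes over a stable ideal trivially. -/
theorem IsHStable.of_mem_minimalPrimes [IsNoetherianRing R] (hdiv : ∀ n : ℕ, 0 < n → ∀ h : H,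
    ∃ g, g ^ n = h) {I Q : Ideal R} (hI : IsHStable ρ I) (hQ : Q ∈ I.minimalPrimes) :
    IsHStable ρ Q := by
  have hcomap : ∀ h (J : Ideal R), J.map (ρ h) = J.comap (ρ h⁻¹) := fun h J => by
    rw [map_inv]
    exact Ideal.map_comap_of_equiv (ρ h : R ≃+* R)
  have hmem : ∀ h, ∀ J ∈ I.minimalPrimes, J.map (ρ h) ∈ I.minimalPrimes := by
    intro h J hJ
    have hJp := hJ.1.1
    refine ⟨⟨?_, ?_⟩, fun L hL hLJ => ?_⟩
    · rw [hcomap]; infer_instance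
    · rw [← hI h]; exact Ideal.map_mono hJ.1.2
    · have hLp := hL.1
      have h1 : L.comap (ρ h) ≤ J := by
        refine (Ideal.comap_mono hLJ).trans ?_
        rw [hcomap]
        intro x hx
        have hx' : ρ h⁻¹ (ρ h x) ∈ J := hx
        rwa [← AlgEquiv.mul_apply, ← map_mul, inv_mul_cancel, map_one] at hx'
      have h2 := hJ.2 ⟨inferInstance, Ideal.map_le_iff_le_comap.mp ((hI h).trans_le hL.2)⟩ h1
      rw [Ideal.map_le_iff_le_comap]
      exact h2
  let act : MulAction H I.minimalPrimes :=
    { smul := fun h J => ⟨J.1.map (ρ h), hmem h J.1 J.2⟩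
      one_smul := fun J => Subtype.ext <| by
        change J.1.map (ρ 1) = J.1
        rw [map_one]
        exact Ideal.map_id _
      mul_smul := fun g h J => Subtype.ext <| by
        change J.1.map (ρ (g * h)) = (J.1.map (ρ h)).map (ρ g)
        rw [hcomap, hcomap, hcomap, mul_inv_rev, map_mul]
        rfl }
  have hfin : Finite I.minimalPrimes :=
    (Ideal.finite_minimalPrimes_of_isNoetherianRing R I).to_subtype
  intro h
  -- Write `h` as a power of `g` whose exponent is the order of the symmetric group on the minimal
  -- primes; such a power acts trivially.
  obtain ⟨g, rfl⟩ := hdiv (Nat.card (Equiv.Perm I.minimalPrimes)) Nat.card_pos h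
  have h1 : MulAction.toPermHom H I.minimalPrimes
      (g ^ Nat.card (Equiv.Perm I.minimalPrimes)) = 1 := by
    rw [map_pow, pow_card_eq_one']
  exact congrArg Subtype.val (congrArg (fun σ => σ ⟨Q, hQ⟩) h1)

end Stable

/-! ### Poisson ideals and elements regular modulo them -/

section Poisson

variable {k R : Type*} [Field k] [CommRing R] [Algebra k R] [PoissonAlgebra k R]

/-- The derivation `{b, ·}`. -/
def poissonDer (k : Type*) {R : Type*} [Field k] [CommRing R] [Algebra k R] [PoissonAlgebra k R]
    (b : R) : Derivation k R R :=
  Derivation.mk' (PoissonAlgebra.bracket (k := k) b) fun x y => by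
    rw [PoissonAlgebra.leibniz, smul_eq_mul, smul_eq_mul]; ring

theorem bracket_eq_neg_poissonDer (a b : R) :
    PoissonAlgebra.bracket (k := k) a b = -poissonDer k b a := by
  have h := PoissonAlgebra.bracket_self (k := k) (a + b)
  simp only [map_add, LinearMap.add_apply, PoissonAlgebra.bracket_self, zero_add, add_zero] at h
  exact eq_neg_of_add_eq_zero_right h

theorem isPoissonIdeal_iff {I : Ideal R} :
    IsPoissonIdeal k I ↔ ∀ b, ∀ a ∈ I, poissonDer k b a ∈ I := by
  simp only [IsPoissonIdeal, bracket_eq_neg_poissonDer, neg_mem_iff]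
  exact ⟨fun h b a ha => h a ha b, fun h a ha b => h b a ha⟩

theorem IsPoissonIdeal.of_mem_minimalPrimes [CharZero k] {I Q : Ideal R}
    (hI : IsPoissonIdeal k I) (hQ : Q ∈ I.minimalPrimes) : IsPoissonIdeal k Q :=
  isPoissonIdeal_iff.mpr fun b _ ha =>
    (poissonDer k b).map_mem_of_mem_minimalPrimes (isPoissonIdeal_iff.mp hI b) hQ ha

theorem IsPoissonIdeal.top : IsPoissonIdeal k (⊤ : Ideal R) := fun _ _ _ => trivial

theorem IsPoissonIdeal.mul {I J : Ideal R} (hI : IsPoissonIdeal k I) (hJ : IsPoissonIdeal k J) :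
    IsPoissonIdeal k (I * J) := by
  rw [isPoissonIdeal_iff] at *
  intro b a ha
  refine Submodule.mul_induction_on ha (fun x hx y hy => ?_) fun x y hx hy => ?_
  · rw [Derivation.leibniz, smul_eq_mul, smul_eq_mul, mul_comm y]
    exact add_mem (Ideal.mul_mem_mul hx (hJ b y hy)) (Ideal.mul_mem_mul (hI b x hx) hy)
  · rw [map_add]; exact add_mem hx hy

theorem IsPoissonIdeal.sup {I J : Ideal R} (hI : IsPoissonIdeal k I) (hJ : IsPoissonIdeal k J) :
    IsPoissonIdeal k (I ⊔ J) := by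
  rw [isPoissonIdeal_iff] at *
  intro b a ha
  obtain ⟨x, hx, y, hy, rfl⟩ := Submodule.mem_sup.mp ha
  rw [map_add]
  exact Submodule.add_mem_sup (hI b x hx) (hJ b y hy)

theorem IsPoissonIdeal.span {s : Set R}
    (h : ∀ a ∈ s, ∀ b, PoissonAlgebra.bracket (k := k) a b ∈ Ideal.span s) :
    IsPoissonIdeal k (Ideal.span s) := by
  rw [isPoissonIdeal_iff]
  intro b a ha
  refine Submodule.span_induction (fun x hx => ?_) (by simp) (fun x y _ _ hx hy => ?_)
    (fun r x hx hy => ?_) ha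
  · have := h x hx b
    rwa [bracket_eq_neg_poissonDer, neg_mem_iff] at this
  · rw [map_add]; exact add_mem hx hy
  · rw [smul_eq_mul, Derivation.leibniz, smul_eq_mul, smul_eq_mul]
    exact add_mem (Ideal.mul_mem_left _ _ hy) (Ideal.mul_mem_right _ _ hx)

/-- If `c` and `{c, R}` generate the unit ideal, then `c` is regular modulo every Poisson ideal. -/
theorem IsPoissonIdeal.mem_of_mul_mem [CharZero k] [IsNoetherianRing R] {I : Ideal R}
    (hI : IsPoissonIdeal k I) {c : R}
    (hc : Ideal.span (insert c (Set.range fun b => poissonDer k b c)) = ⊤) {a : R}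
    (ha : c * a ∈ I) : a ∈ I := by
  have hI' := isPoissonIdeal_iff.mp hI
  -- If one power of `c` can be cancelled at level `n + 2`, it can at level `n + 1`. Bracketing `c ^
  -- (n + 1) * x` with `b` gives `(n + 1) * c ^ n * x * {b, c} + c ^ (n + 1) * {b, x}`, whose second
  -- term lies in `I` by the hypothesis. So `c ^ n * x` is carried into `I` by `c` and by every `{b,
  -- c}`, hence by 1.
  have step : ∀ n : ℕ, (∀ x, c ^ (n + 2) * x ∈ I → c ^ (n + 1) * x ∈ I) →
      ∀ x, c ^ (n + 1) * x ∈ I → c ^ n * x ∈ I := by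
    intro n hn x hx
    have hder : ∀ b, c ^ n * x * poissonDer k b c ∈ I := by
      intro b
      have h1 := hI' b _ hx
      have h2 : c ^ (n + 1) * poissonDer k b x ∈ I := by
        refine hn _ ?_
        have h3 := I.mul_mem_left c h1
        have h4 := I.mul_mem_left (((n + 1 : ℕ) : R) * poissonDer k b c) hx
        convert I.sub_mem h3 h4 using 1
        simp only [Derivation.leibniz, Derivation.leibniz_pow, smul_eq_mul, nsmul_eq_mul,
          Nat.add_sub_cancel]
        ring
      have h3 : ((n + 1 : ℕ) : R) * (c ^ n * x * poissonDer k b c) ∈ I := by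
        convert I.sub_mem h1 h2 using 1
        simp only [Derivation.leibniz, Derivation.leibniz_pow, smul_eq_mul, nsmul_eq_mul,
          Nat.add_sub_cancel]
        ring
      have h5 := I.mul_mem_left (algebraMap k R ((n + 1 : ℕ) : k)⁻¹) h3
      rwa [← mul_assoc, ← map_natCast (algebraMap k R), ← map_mul,
        inv_mul_cancel₀ (Nat.cast_ne_zero.mpr n.succ_ne_zero), map_one, one_mul] at h5
    have hall : ∀ y ∈ Ideal.span (insert c (Set.range fun b => poissonDer k b c)),
        c ^ n * x * y ∈ I := by
      intro y hy
      refine Submodule.span_induction ?_ (by simp) (fun u v _ _ hu hv => ?_)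
        (fun r u _ hu => ?_) hy
      · rintro _ (rfl | ⟨b, rfl⟩)
        · convert hx using 1; ring
        · exact hder b
      · rw [mul_add]; exact add_mem hu hv
      · convert I.mul_mem_left r hu using 1; rw [smul_eq_mul]; ring
    simpa using hall 1 (by rw [hc]; trivial)
  -- The ascending chain of ideals `I : c ^ n` stabilises, which starts the downward induction.
  let K : ℕ →o Ideal R :=
    { toFun := fun n => I.colon {c ^ n}
      monotone' := fun m n hmn x hx => by
        simp only [Submodule.mem_colon_singleton, smul_eq_mul] at hx ⊢
        rw [← Nat.add_sub_of_le hmn, pow_add, ← mul_assoc]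
        exact I.mul_mem_right _ hx }
  have hK : ∀ n x, x ∈ K n ↔ c ^ n * x ∈ I := fun n x => by
    refine Submodule.mem_colon_singleton.trans ?_
    rw [smul_eq_mul, mul_comm]
  obtain ⟨N, hN⟩ := monotone_stabilizes_iff_noetherian.mpr ‹IsNoetherianRing R› K
  have down : ∀ n, ∀ x, c ^ (n + 1) * x ∈ I → c ^ n * x ∈ I := by
    have top : ∀ n, N ≤ n → ∀ x, c ^ (n + 1) * x ∈ I → c ^ n * x ∈ I := fun n hn x hx => by
      rw [← hK] at hx ⊢
      rwa [← hN n hn, hN (n + 1) (by omega)]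
    intro n
    by_cases hn : N ≤ n
    · exact top n hn
    · exact Nat.decreasingInduction' (P := fun n => ∀ x, c ^ (n + 1) * x ∈ I → c ^ n * x ∈ I)
        (fun m _ _ ih => step m ih) (le_of_not_ge hn) (top N le_rfl)
  simpa using down 0 a (by simpa using ha)

/-! ## Poisson `H`-primes are prime -/

variable {H : Type*} [Group H] {ρ : H →* (R ≃ₐ[k] R)}

theorem IsPoissonHPrime.exists_le_of_prod_le {P : Ideal R} (hP : IsPoissonHPrime ρ P)
    (s : Finset (Ideal R)) (hs : ∀ J ∈ s, IsPoissonIdeal k J ∧ IsHStable ρ J)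
    (h : ∏ J ∈ s, J ≤ P) : ∃ J ∈ s, J ≤ P := by
  classical
  have aux : ∀ s : Finset (Ideal R), (∀ J ∈ s, IsPoissonIdeal k J ∧ IsHStable ρ J) →
      IsPoissonIdeal k (∏ J ∈ s, J) ∧ IsHStable ρ (∏ J ∈ s, J) := fun s hs =>
    Finset.prod_induction _ (fun J => IsPoissonIdeal k J ∧ IsHStable ρ J)
      (fun _ _ h1 h2 => ⟨h1.1.mul h2.1, h1.2.mul h2.2⟩)
      (by rw [Ideal.one_eq_top]; exact ⟨.top, .top⟩) hs
  induction s using Finset.induction_on with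
  | empty =>
    rw [Finset.prod_empty, Ideal.one_eq_top, top_le_iff] at h
    exact absurd h hP.ne_top
  | insert J s hJ ih =>
    rw [Finset.prod_insert hJ] at h
    have h1 := hs J (Finset.mem_insert_self J s)
    have h2 := aux s fun L hL => hs L (Finset.mem_insert_of_mem hL)
    rcases hP.le_or_le _ _ h1.1 h1.2 h2.1 h2.2 h with h3 | h3
    · exact ⟨J, Finset.mem_insert_self J s, h3⟩
    · obtain ⟨L, hL, hLP⟩ := ih (fun L hL => hs L (Finset.mem_insert_of_mem hL)) h3
      exact ⟨L, Finset.mem_insert_of_mem hL, hLP⟩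

/-- In characteristic zero, a Poisson `H`-prime of a Noetherian Poisson algebra with an action of a
divisible group `H` is prime. -/
theorem IsPoissonHPrime.isPrime [CharZero k] [IsNoetherianRing R] (hdiv : ∀ n : ℕ, 0 < n →
    ∀ h : H, ∃ g, g ^ n = h) {P : Ideal R} (hP : IsPoissonHPrime ρ P) : P.IsPrime := by
  have hfin := Ideal.finite_minimalPrimes_of_isNoetherianRing R P
  have hmin : ∀ J ∈ hfin.toFinset, IsPoissonIdeal k J ∧ IsHStable ρ J := fun J hJ => by
    rw [Set.Finite.mem_toFinset] at hJ
    exact ⟨hP.poisson.of_mem_minimalPrimes hJ, hP.stable.of_mem_minimalPrimes hdiv hJ⟩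
  obtain ⟨n, hn⟩ := P.exists_radical_pow_le_of_fg (IsNoetherian.noetherian _)
  have hprod : ∏ J ∈ hfin.toFinset, J ≤ P.radical := by
    rw [← Ideal.sInf_minimalPrimes]
    refine le_sInf fun J hJ => ?_
    exact Ideal.le_of_dvd (Finset.dvd_prod_of_mem _ (hfin.mem_toFinset.mpr hJ))
  have hpow : ∀ n : ℕ, (∏ J ∈ hfin.toFinset, J) ^ n ≤ P → ∃ J ∈ hfin.toFinset, J ≤ P := by
    intro n
    induction n with
    | zero =>
      intro h
      rw [pow_zero, Ideal.one_eq_top, top_le_iff] at h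
      exact absurd h hP.ne_top
    | succ n ih =>
      intro h
      have aux := Finset.prod_induction (fun J : Ideal R => J)
        (fun J => IsPoissonIdeal k J ∧ IsHStable ρ J)
        (fun _ _ h1 h2 => ⟨h1.1.mul h2.1, h1.2.mul h2.2⟩)
        (by rw [Ideal.one_eq_top]; exact ⟨.top, .top⟩) hmin
      have auxp : ∀ n : ℕ, IsPoissonIdeal k ((∏ J ∈ hfin.toFinset, J) ^ n) ∧
          IsHStable ρ ((∏ J ∈ hfin.toFinset, J) ^ n) := fun n => by
        induction n with
        | zero => rw [pow_zero, Ideal.one_eq_top]; exact ⟨.top, .top⟩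
        | succ n ih => rw [pow_succ]; exact ⟨ih.1.mul aux.1, ih.2.mul aux.2⟩
      rw [pow_succ] at h
      rcases hP.le_or_le _ _ (auxp n).1 (auxp n).2 aux.1 aux.2 h with h1 | h1
      · exact ih h1
      · exact hP.exists_le_of_prod_le _ hmin h1
  obtain ⟨J, hJ, hJP⟩ := hpow n ((Ideal.pow_right_mono hprod n).trans hn)
  rw [Set.Finite.mem_toFinset] at hJ
  rw [hJP.antisymm hJ.1.2] at hJ
  exact hJ.1.1

end Poisson

/-! ## Brackets of minors for the standard bracket -/

/-- `D` takes the values of the standard bracket on the entries of the matrix `x`. -/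
def IsStdBracket {k R : Type*} [Field k] [CommRing R] [Algebra k R]
    (D : Derivation k R (Derivation k R R)) (x : Fin 3 → Fin 3 → R) : Prop :=
  ∀ i j l m, D (x i j) (x l m) = ((ordSign i l + ordSign j m : ℤ) : R) * (x i m * x l j)

/-- The `2 × 2` minor with rows `i, l` and columns `j, m`. -/
def minor {R : Type*} [CommRing R] (x : Fin 3 → Fin 3 → R) (i l j m : Fin 3) : R :=
  x i j * x l m - x i m * x l j

namespace IsStdBracket

variable {k R : Type*} [Field k] [CommRing R] [Algebra k R]
  {D : Derivation k R (Derivation k R R)} {x : Fin 3 → Fin 3 → R}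

theorem minor_coord (h : IsStdBracket D x) (i l j m p q : Fin 3) :
    D (minor x i l j m) (x p q) =
      ((ordSign i p + ordSign j q : ℤ) : R) * (x l m * (x i q * x p j)) +
      ((ordSign l p + ordSign m q : ℤ) : R) * (x i j * (x l q * x p m)) -
      ((ordSign i p + ordSign m q : ℤ) : R) * (x l j * (x i q * x p m)) -
      ((ordSign l p + ordSign j q : ℤ) : R) * (x i m * (x l q * x p j)) := by
  simp only [minor, map_sub, Derivation.leibniz, Derivation.sub_apply, Derivation.add_apply,
    Derivation.smul_apply, smul_eq_mul, h _ _ _ _]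
  ring

/-- This minor is Poisson normal: its bracket with each coordinate is an integer multiple of the
product. Hence it generates a Poisson ideal. -/
theorem upperMinor_coord (h : IsStdBracket D x) (i j : Fin 3) :
    D (minor x 0 1 1 2) (x i j) =
      ((![![-1, 0, 0], ![-1, 0, 0], ![0, 1, 1]] i j : ℤ) : R) * x i j * minor x 0 1 1 2 := by
  rw [h.minor_coord]
  fin_cases i <;> fin_cases j <;> simp [ordSign, minor] <;> ring

theorem det_coord (h : IsStdBracket D x) {d : R}
    (hd : d = x 0 0 * minor x 1 2 1 2 - x 0 1 * minor x 1 2 0 2 + x 0 2 * minor x 1 2 0 1)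
    (i j : Fin 3) : D d (x i j) = 0 := by
  subst hd
  simp only [map_add, map_sub, Derivation.leibniz, Derivation.sub_apply, Derivation.add_apply,
    Derivation.smul_apply, smul_eq_mul, h _ _ _ _, h.minor_coord]
  fin_cases i <;> fin_cases j <;> simp [ordSign, minor] <;> ring

theorem coord_minor (h : IsStdBracket D x) (i l j m p q : Fin 3) :
    D (x p q) (minor x i l j m) =
      ((ordSign p i + ordSign q j : ℤ) : R) * (x l m * (x p j * x i q)) +
      ((ordSign p l + ordSign q m : ℤ) : R) * (x i j * (x p m * x l q)) -
      ((ordSign p i + ordSign q m : ℤ) : R) * (x l j * (x p m * x i q)) -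
      ((ordSign p l + ordSign q j : ℤ) : R) * (x i m * (x p j * x l q)) := by
  simp only [minor, map_sub, Derivation.leibniz, smul_eq_mul, h _ _ _ _]
  ring

/-- Leibniz is applied in the second argument only, so that the remaining brackets are those
computed by `minor_coord`. -/
theorem lead_minor (i l j m : Fin 3) :
    D (minor x 0 1 0 1) (minor x i l j m) =
      x l m * D (minor x 0 1 0 1) (x i j) + x i j * D (minor x 0 1 0 1) (x l m) -
      x l j * D (minor x 0 1 0 1) (x i m) - x i m * D (minor x 0 1 0 1) (x l j) := by
  rw [minor, minor, map_sub (D _), Derivation.leibniz, Derivation.leibniz]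
  simp only [smul_eq_mul]
  ring

end IsStdBracket

/-- The functions whose monomials span the strata of the classification: the leading principal
minors, followed by entries and minors above and below the diagonal. -/
def clusterVar {R : Type*} [CommRing R] (x : Fin 3 → Fin 3 → R) (d : R) : Fin 11 → R :=
  ![x 0 0, minor x 0 1 0 1, d, x 0 1, x 0 2, minor x 0 1 1 2, x 1 2,
    x 1 0, x 2 0, minor x 1 2 0 1, x 2 1]

namespace IsStdBracket

variable {k R : Type*} [Field k] [CommRing R] [Algebra k R]
  {D : Derivation k R (Derivation k R R)} {x : Fin 3 → Fin 3 → R} {d : R} {I : Ideal R}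

/-- The vector lists the exponents l_i with {x00, y_i} = l_i x00 y_i. The two exceptions are {x00,
x12} = 2 x02 x10 and {x00, x21} = 2 x01 x20, which vanish only modulo x02 and x20 respectively. -/
theorem x00_clusterVar (h : IsStdBracket D x) (hd : ∀ f, D f d = 0) (i : Fin 11)
    (h6 : i = 6 → x 0 2 ∈ I) (h10 : i = 10 → x 2 0 ∈ I) :
    D (x 0 0) (clusterVar x d i) -
      ((![0, 0, 0, 1, 1, 1, 0, 1, 1, 1, 0] i : ℤ) : R) * (x 0 0 * clusterVar x d i) ∈ I := by
  obtain rfl | n6 := eq_or_ne i 6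
  · convert I.mul_mem_left (2 * x 1 0) (h6 rfl) using 1
    simp [clusterVar, h _ _ _ _, ordSign]; ring
  obtain rfl | n10 := eq_or_ne i 10
  · convert I.mul_mem_left (2 * x 0 1) (h10 rfl) using 1
    simp [clusterVar, h _ _ _ _, ordSign]; ring
  fin_cases i <;> first | exact absurd rfl n6 | exact absurd rfl n10 | skip
  all_goals
    convert I.zero_mem using 1
    simp [clusterVar, h _ _ _ _, hd, h.coord_minor, ordSign]
    try simp only [minor]
    try ring

theorem lead_clusterVar (h : IsStdBracket D x) (hd : ∀ f, D f d = 0) (i : Fin 11) :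
    D (minor x 0 1 0 1) (clusterVar x d i) =
      ((![0, 0, 0, 0, 1, 1, 1, 0, 1, 1, 1] i : ℤ) : R) *
        (minor x 0 1 0 1 * clusterVar x d i) := by
  obtain rfl | n6 := eq_or_ne i 6
  · simp [clusterVar, h.minor_coord, ordSign]; simp only [minor]; ring
  obtain rfl | n10 := eq_or_ne i 10
  · simp [clusterVar, h.minor_coord, ordSign]; simp only [minor]; ring
  fin_cases i <;> first | exact absurd rfl n6 | exact absurd rfl n10 | skip
  all_goals
    simp [clusterVar, hd, h.minor_coord, lead_minor, ordSign]
    try simp only [minor]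
    try ring

/-- The excluded index is x12, since {x01, x12} = 2 x02 x11 is not log-canonical. -/
theorem x01_clusterVar (h : IsStdBracket D x) (hd : ∀ f, D f d = 0) (i : Fin 11)
    (h6 : i ≠ 6) :
    D (x 0 1) (clusterVar x d i) =
      ((![-1, 0, 0, 0, 1, 0, 0, 0, 0, 1, 1] i : ℤ) : R) * (x 0 1 * clusterVar x d i) := by
  fin_cases i <;> first | exact absurd rfl h6 | skip
  all_goals
    simp [clusterVar, h _ _ _ _, hd, h.coord_minor, ordSign]
    try simp only [minor]
    try ring

theorem x10_clusterVar (h : IsStdBracket D x) (hd : ∀ f, D f d = 0) (i : Fin 11)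
    (h10 : i ≠ 10) :
    D (x 1 0) (clusterVar x d i) =
      ((![-1, 0, 0, 0, 0, 1, 1, 0, 1, 0, 0] i : ℤ) : R) * (x 1 0 * clusterVar x d i) := by
  fin_cases i <;> first | exact absurd rfl h10 | skip
  all_goals
    simp [clusterVar, h _ _ _ _, hd, h.coord_minor, ordSign]
    try simp only [minor]
    try ring

end IsStdBracket

/-! ## The strata above the diagonal -/

/-- Generators above the diagonal, for `321`, `231`, `312`, `132`, `213`, `123`. -/
def upperSet {R : Type*} [CommRing R] (x : Fin 3 → Fin 3 → R) : Fin 6 → Set R :=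
  ![∅, {minor x 0 1 1 2}, {x 0 2}, {x 0 1, x 0 2}, {x 0 2, x 1 2}, {x 0 1, x 0 2, x 1 2}]

/-- The cluster variables above the diagonal which do not vanish on the stratum. -/
def upperActive : Fin 6 → Finset (Fin 11) := ![{3, 4, 5}, {3, 4}, {3, 6}, {6}, {3}, ∅]

/-- The cluster variables below the diagonal which do not vanish on the stratum. -/
def lowerActive : Fin 6 → Finset (Fin 11) := ![{7, 8, 9}, {7, 8}, {7, 10}, {10}, {7}, ∅]

namespace IsStdBracket

variable {k R : Type*} [Field k] [CommRing R] [Algebra k R]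
  {D : Derivation k R (Derivation k R R)} {x : Fin 3 → Fin 3 → R}

/-- Exchanging rows and columns preserves the bracket; the results below the diagonal are deduced
from those above it in this way. -/
theorem transpose (h : IsStdBracket D x) : IsStdBracket D fun i j => x j i := fun i j l m => by
  rw [h, add_comm (ordSign _ _), mul_comm (x m i)]

theorem coord_mem (h : IsStdBracket D x) {I : Ideal R} {i j l m : Fin 3}
    (H : ordSign i l + ordSign j m = 0 ∨ x i m ∈ I ∨ x l j ∈ I) : D (x i j) (x l m) ∈ I := by
  rw [h]
  rcases H with H | H | H
  · rw [H]; simp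
  · exact I.mul_mem_left _ (I.mul_mem_right _ H)
  · exact I.mul_mem_left _ (I.mul_mem_left _ H)

theorem upperSet_coord_mem (h : IsStdBracket D x) (c : Fin 6) {g : R} (hg : g ∈ upperSet x c)
    (i j : Fin 3) : D g (x i j) ∈ Ideal.span (upperSet x c) := by
  have hsub : ∀ f ∈ upperSet x c, f ∈ Ideal.span (upperSet x c) :=
    fun f hf => Ideal.subset_span hf
  -- Only the membership of the generators in the ideal is used from here on.
  generalize Ideal.span (upperSet x c) = I at *
  fin_cases c <;> simp [upperSet] at hg hsub
  · rw [hg, h.upperMinor_coord]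
    exact I.mul_mem_left _ hsub
  all_goals
    try rcases hg with rfl | rfl | rfl
    try rcases hg with rfl | rfl
    try subst hg
    all_goals
      fin_cases i <;> fin_cases j <;> apply h.coord_mem <;> simp [ordSign, hsub]

variable {J : Ideal R}

/-- For i, j ≥ 1 one has {x00, x_ij} = 2 x_0j x_i0, and each term of det without x00 contains such a
product. `J` need not be Poisson, so the lemma also applies to the ideal generated by x00 and its
brackets. -/
theorem det_mem_of_x00_mem (h : IsStdBracket D x) (h2 : ∀ a : R, 2 * a ∈ J → a ∈ J)
    (h0 : x 0 0 ∈ J) (hJ : ∀ b, D (x 0 0) b ∈ J) :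
    x 0 0 * minor x 1 2 1 2 - x 0 1 * minor x 1 2 0 2 + x 0 2 * minor x 1 2 0 1 ∈ J := by
  have key : ∀ i j : Fin 3, i ≠ 0 → j ≠ 0 → x 0 j * x i 0 ∈ J := by
    intro i j hi hj
    apply h2
    have h1 := hJ (x i j)
    rw [h] at h1
    convert h1 using 2
    fin_cases i <;> fin_cases j <;> simp [ordSign] at hi hj ⊢
  have e : x 0 0 * minor x 1 2 1 2 - x 0 1 * minor x 1 2 0 2 + x 0 2 * minor x 1 2 0 1 =
      minor x 1 2 1 2 * x 0 0 - x 2 2 * (x 0 1 * x 1 0) + x 1 2 * (x 0 1 * x 2 0) +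
        x 2 1 * (x 0 2 * x 1 0) - x 1 1 * (x 0 2 * x 2 0) := by
    simp only [minor]; ring
  rw [e]
  exact J.sub_mem (J.add_mem (J.add_mem (J.sub_mem (J.mul_mem_left _ h0)
    (J.mul_mem_left _ (key 1 1 (by decide) (by decide))))
    (J.mul_mem_left _ (key 2 1 (by decide) (by decide))))
    (J.mul_mem_left _ (key 1 2 (by decide) (by decide))))
    (J.mul_mem_left _ (key 2 2 (by decide) (by decide)))

/-- The argument for x00 carried over to the matrix of 2×2 minors (the second compound), whose
determinant is det². The brackets of its corner entry Δ with the minors outside its row and column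
are twice the products of border entries. -/
theorem det_sq_mem_of_lead_mem (h : IsStdBracket D x) (h2 : ∀ a : R, 2 * a ∈ J → a ∈ J)
    (h0 : minor x 0 1 0 1 ∈ J) (hJ : ∀ b, D (minor x 0 1 0 1) b ∈ J) :
    (x 0 0 * minor x 1 2 1 2 - x 0 1 * minor x 1 2 0 2 + x 0 2 * minor x 1 2 0 1) ^ 2 ∈ J := by
  have h00 : minor x 1 2 0 1 * minor x 0 1 1 2 ∈ J := by
    apply h2
    convert hJ (minor x 1 2 1 2) using 1
    rw [lead_minor]; simp [h.minor_coord, ordSign]; simp only [minor]; ring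
  have h01 : minor x 1 2 0 1 * minor x 0 1 0 2 ∈ J := by
    apply h2
    convert hJ (minor x 1 2 0 2) using 1
    rw [lead_minor]; simp [h.minor_coord, ordSign]; simp only [minor]; ring
  have h10 : minor x 0 2 0 1 * minor x 0 1 1 2 ∈ J := by
    apply h2
    convert hJ (minor x 0 2 1 2) using 1
    rw [lead_minor]; simp [h.minor_coord, ordSign]; simp only [minor]; ring
  have h11 : minor x 0 2 0 1 * minor x 0 1 0 2 ∈ J := by
    apply h2
    convert hJ (minor x 0 2 0 2) using 1
    rw [lead_minor]; simp [h.minor_coord, ordSign]; simp only [minor]; ring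
  have e : (x 0 0 * minor x 1 2 1 2 - x 0 1 * minor x 1 2 0 2 + x 0 2 * minor x 1 2 0 1) ^ 2 =
      (minor x 1 2 1 2 * minor x 0 2 0 2 - minor x 1 2 0 2 * minor x 0 2 1 2) *
        minor x 0 1 0 1 - minor x 1 2 1 2 * (minor x 0 2 0 1 * minor x 0 1 0 2) +
        minor x 0 2 1 2 * (minor x 1 2 0 1 * minor x 0 1 0 2) +
        minor x 1 2 0 2 * (minor x 0 2 0 1 * minor x 0 1 1 2) -
        minor x 0 2 0 2 * (minor x 1 2 0 1 * minor x 0 1 1 2) := by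
    simp only [minor]; ring
  rw [e]
  exact J.sub_mem (J.add_mem (J.add_mem (J.sub_mem (J.mul_mem_left _ h0) (J.mul_mem_left _ h11))
    (J.mul_mem_left _ h01)) (J.mul_mem_left _ h10)) (J.mul_mem_left _ h00)

/-- A Poisson prime lies in one of the six strata above the diagonal. -/
theorem exists_upper (h : IsStdBracket D x) {P : Ideal R} [hp : P.IsPrime]
    (h2 : ∀ a : R, 2 * a ∈ P → a ∈ P) (hP : ∀ a ∈ P, ∀ b, D a b ∈ P)
    (hd : x 0 0 * minor x 1 2 1 2 - x 0 1 * minor x 1 2 0 2 + x 0 2 * minor x 1 2 0 1 ∉ P)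
    (d : R) : ∃ c, upperSet x c ⊆ P ∧ ∀ i ∈ upperActive c, clusterVar x d i ∉ P := by
  by_cases h02 : x 0 2 ∈ P
  · by_cases h01 : x 0 1 ∈ P <;> by_cases h12 : x 1 2 ∈ P
    · exact ⟨5, by simp [upperSet, Set.insert_subset_iff, *], by simp [upperActive]⟩
    · exact ⟨3, by simp [upperSet, Set.insert_subset_iff, *],
        by simpa [upperActive, clusterVar] using h12⟩
    · exact ⟨4, by simp [upperSet, Set.insert_subset_iff, *],
        by simpa [upperActive, clusterVar] using h01⟩
    · exact ⟨2, by simp [upperSet, *], by simpa [upperActive, clusterVar] using ⟨h01, h12⟩⟩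
  · have h01 : x 0 1 ∉ P := by
      intro h01
      -- Here {x01, x_i2} = 2 x02 x_i1, so column 1 lies in `P`, and with it det.
      have key : ∀ i, i ≠ 0 → x i 1 ∈ P := by
        intro i hi
        have h3 := hP _ h01 (x i 2)
        rw [h] at h3
        have h4 : 2 * (x 0 2 * x i 1) ∈ P := by
          convert h3 using 2
          fin_cases i <;> simp [ordSign] at hi ⊢
        exact (hp.mem_or_mem (h2 _ h4)).resolve_left h02
      refine hd ?_
      have e : x 0 0 * minor x 1 2 1 2 - x 0 1 * minor x 1 2 0 2 + x 0 2 * minor x 1 2 0 1 =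
          (x 0 0 * x 2 2 - x 0 2 * x 2 0) * x 1 1 - (x 0 0 * x 1 2 - x 0 2 * x 1 0) * x 2 1 -
            minor x 1 2 0 2 * x 0 1 := by
        simp only [minor]; ring
      rw [e]
      exact P.sub_mem (P.sub_mem (P.mul_mem_left _ (key 1 (by decide)))
        (P.mul_mem_left _ (key 2 (by decide)))) (P.mul_mem_left _ h01)
    by_cases hm : minor x 0 1 1 2 ∈ P
    · exact ⟨1, by simp [upperSet, *], by simpa [upperActive, clusterVar] using ⟨h01, h02⟩⟩
    · exact ⟨0, by simp [upperSet],
        by simpa [upperActive, clusterVar] using ⟨h01, h02, hm⟩⟩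

theorem exists_lower (h : IsStdBracket D x) {P : Ideal R} [hp : P.IsPrime]
    (h2 : ∀ a : R, 2 * a ∈ P → a ∈ P) (hP : ∀ a ∈ P, ∀ b, D a b ∈ P)
    (hd : x 0 0 * minor x 1 2 1 2 - x 0 1 * minor x 1 2 0 2 + x 0 2 * minor x 1 2 0 1 ∉ P)
    (d : R) : ∃ c, upperSet (fun i j => x j i) c ⊆ P ∧
      ∀ i ∈ lowerActive c, clusterVar x d i ∉ P := by
  obtain ⟨c, h1, h3⟩ := h.transpose.exists_upper h2 hP (by
    convert hd using 2
    simp only [minor]; ring) d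
  refine ⟨c, h1, ?_⟩
  have hm : minor (fun i j => x j i) 0 1 1 2 = minor x 1 2 0 1 := by simp only [minor]; ring
  fin_cases c <;> simpa [upperActive, lowerActive, clusterVar, hm] using h3

end IsStdBracket

/-! ## Generation up to denominators -/

/-- The elements which modulo `I` are fractions with numerator in `A` and denominator in `M`. -/
def fractionSubalgebra {k R : Type*} [Field k] [CommRing R] [Algebra k R] (I : Ideal R)
    (A : Subalgebra k R) (M : Submonoid R) : Subalgebra k R where
  carrier := {a | ∃ μ ∈ M ⊓ A.toSubmonoid, ∃ b ∈ A, μ * a - b ∈ I}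
  mul_mem' := by
    rintro a a' ⟨μ, hμ, b, hb, h⟩ ⟨μ', hμ', b', hb', h'⟩
    refine ⟨μ * μ', mul_mem hμ hμ', b * b', mul_mem hb hb', ?_⟩
    convert I.add_mem (I.mul_mem_left (μ' * a') h) (I.mul_mem_left b h') using 1
    ring
  add_mem' := by
    rintro a a' ⟨μ, hμ, b, hb, h⟩ ⟨μ', hμ', b', hb', h'⟩
    refine ⟨μ * μ', mul_mem hμ hμ', μ' * b + μ * b',
      add_mem (mul_mem hμ'.2 hb) (mul_mem hμ.2 hb'), ?_⟩
    convert I.add_mem (I.mul_mem_left μ' h) (I.mul_mem_left μ h') using 1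
    ring
  algebraMap_mem' r := ⟨1, one_mem _, algebraMap k R r, A.algebraMap_mem r, by simp⟩

section Fractions

variable {k R : Type*} [Field k] [CommRing R] [Algebra k R] {I : Ideal R}
  {A : Subalgebra k R} {M : Submonoid R}

theorem mem_fractionSubalgebra {a : R} : a ∈ fractionSubalgebra I A M ↔
    ∃ μ ∈ M ⊓ A.toSubmonoid, ∃ b ∈ A, μ * a - b ∈ I := Iff.rfl

theorem mem_fractionSubalgebra_of_mem_ideal {a : R} (ha : a ∈ I) :
    a ∈ fractionSubalgebra I A M :=
  ⟨1, one_mem _, 0, zero_mem _, by simpa using ha⟩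

theorem mem_fractionSubalgebra_of_mem {a : R} (ha : a ∈ A) : a ∈ fractionSubalgebra I A M :=
  ⟨1, one_mem _, a, ha, by simp⟩

theorem mem_fractionSubalgebra_of_mul_mem {μ a : R} (hμ : μ ∈ M) (hμA : μ ∈ A)
    (h : μ * a ∈ fractionSubalgebra I A M) : a ∈ fractionSubalgebra I A M := by
  obtain ⟨ν, hν, b, hb, h⟩ := h
  exact ⟨ν * μ, mul_mem hν ⟨hμ, hμA⟩, b, hb, by rwa [mul_assoc]⟩

/-- If `R` is generated up to denominators, modulo `I`, by elements whose images under `φ` are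
algebraically independent, and `I` is saturated, then `I` is the kernel of `φ`. -/
theorem ker_eq_of_fractionSubalgebra_eq_top {F ι : Type*} [CommRing F] [IsDomain F] [Algebra k F]
    (φ : R →ₐ[k] F) (hI : I ≤ RingHom.ker φ) {z : ι → R}
    (hz : AlgebraicIndependent k (φ ∘ z))
    (htop : fractionSubalgebra I (Algebra.adjoin k (Set.range z)) M = ⊤)
    (hM : ∀ μ ∈ M, ∀ a, μ * a ∈ I → a ∈ I) : RingHom.ker φ = I := by
  refine le_antisymm (fun a ha => ?_) hI
  obtain ⟨μ, hμ, b, hb, h⟩ := mem_fractionSubalgebra.mp (htop ▸ Algebra.mem_top : a ∈ _)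
  have hφb : φ b = 0 := by
    have h1 : φ (μ * a - b) = 0 := hI h
    rw [RingHom.mem_ker] at ha
    rwa [map_sub, map_mul, ha, mul_zero, zero_sub, neg_eq_zero] at h1
  rw [Algebra.adjoin_range_eq_range_aeval] at hb
  obtain ⟨p, rfl⟩ := hb
  have hp : aeval (φ ∘ z) p = 0 := by
    rw [← hφb]
    exact (MvPolynomial.comp_aeval_apply (f := z) φ p).symm
  rw [(injective_iff_map_eq_zero _).mp hz p hp, AlgHom.toRingHom_eq_coe, map_zero, sub_zero] at h
  exact hM μ hμ.1 a h

/-- If `R` is generated up to denominators, modulo the prime `I`, by elements spanned by a family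
which is linearly independent modulo `P`, then `P ≤ I`. -/
theorem le_of_fractionSubalgebra_eq_top {τ : Type*} {P : Ideal R} (hI : I.IsPrime) (hIP : I ≤ P)
    {v : τ → R} (hA : ∀ b ∈ A, b ∈ Submodule.span k (Set.range v))
    (hv : ∀ f : τ →₀ k, (f.sum fun t a => a • v t) ∈ P → f = 0)
    (htop : fractionSubalgebra I A M = ⊤) (hM : ∀ μ ∈ M, μ ∉ I) : P ≤ I := by
  intro a ha
  obtain ⟨μ, hμ, b, hb, h⟩ := mem_fractionSubalgebra.mp (htop ▸ Algebra.mem_top : a ∈ _)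
  obtain ⟨f, rfl⟩ := Finsupp.mem_span_range_iff_exists_finsupp.mp (hA b hb)
  have hf : (f.sum fun t a => a • v t) ∈ P := by
    have h1 := P.sub_mem (P.mul_mem_left μ ha) (hIP h)
    rwa [sub_sub_cancel] at h1
  rw [hv f hf, Finsupp.sum_zero_index, sub_zero] at h
  exact (hI.mem_or_mem h).resolve_left (hM μ hμ.1)

end Fractions

/-! ### Recovering matrix entries by division -/

section Coordinates

variable {k R : Type*} [Field k] [CommRing R] [Algebra k R] {x : Fin 3 → Fin 3 → R} {d : R}
  {S : Subalgebra k R}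

/-- `S` plays the role of a fraction subalgebra, closed under division by active variables. In the
first two strata x12 is obtained from x01 x12 = (x01 x12 - x02 x11) + x02 x11, which is why x11 is
needed. -/
theorem upper_mem_of_upperActive {c : Fin 6} (hS : upperSet x c ⊆ S)
    (hact : ∀ i ∈ upperActive c, clusterVar x d i ∈ S ∧
      ∀ a, clusterVar x d i * a ∈ S → a ∈ S) :
    x 0 1 ∈ S ∧ x 0 2 ∈ S ∧ (x 1 1 ∈ S → x 1 2 ∈ S) := by
  have e : x 0 1 * x 1 2 = minor x 0 1 1 2 + x 0 2 * x 1 1 := by simp only [minor]; ring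
  fin_cases c <;> simp [upperSet, upperActive, clusterVar, Set.insert_subset_iff] at hS hact
  · exact ⟨hact.1.1, hact.2.1.1, fun h => hact.1.2 _
      (e ▸ add_mem hact.2.2.1 (mul_mem hact.2.1.1 h))⟩
  · exact ⟨hact.1.1, hact.2.1, fun h => hact.1.2 _ (e ▸ add_mem hS (mul_mem hact.2.1 h))⟩
  · exact ⟨hact.1.1, hS, fun _ => hact.2.1⟩
  · exact ⟨hS.1, hS.2, fun _ => hact.1⟩
  · exact ⟨hact.1, hS.1, fun _ => hS.2⟩
  · exact ⟨hS.1, hS.2.1, fun _ => hS.2.2⟩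

theorem lower_mem_of_lowerActive {c : Fin 6} (hS : upperSet (fun i j => x j i) c ⊆ S)
    (hact : ∀ i ∈ lowerActive c, clusterVar x d i ∈ S ∧
      ∀ a, clusterVar x d i * a ∈ S → a ∈ S) :
    x 1 0 ∈ S ∧ x 2 0 ∈ S ∧ (x 1 1 ∈ S → x 2 1 ∈ S) := by
  refine upper_mem_of_upperActive (x := fun i j => x j i) (d := d) hS ?_
  have hm : minor (fun i j => x j i) 0 1 1 2 = minor x 1 2 0 1 := by simp only [minor]; ring
  fin_cases c <;> simpa [upperActive, lowerActive, clusterVar, hm] using hact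

/-- Division by x00 yields x11 from Δ + x01 x10; then division by Δ yields x22 from det plus terms
free of x22. -/
theorem coord_mem_of_gauss (h00 : x 0 0 ∈ S) (hl : minor x 0 1 0 1 ∈ S)
    (hd : x 0 0 * minor x 1 2 1 2 - x 0 1 * minor x 1 2 0 2 + x 0 2 * minor x 1 2 0 1 ∈ S)
    (h00' : ∀ a, x 0 0 * a ∈ S → a ∈ S) (hl' : ∀ a, minor x 0 1 0 1 * a ∈ S → a ∈ S)
    (h01 : x 0 1 ∈ S) (h02 : x 0 2 ∈ S) (h12 : x 1 1 ∈ S → x 1 2 ∈ S)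
    (h10 : x 1 0 ∈ S) (h20 : x 2 0 ∈ S) (h21 : x 1 1 ∈ S → x 2 1 ∈ S) (i j : Fin 3) :
    x i j ∈ S := by
  have h11 : x 1 1 ∈ S := h00' _ (by
    convert add_mem hl (mul_mem h01 h10) using 1
    simp only [minor]; ring)
  have h22 : x 2 2 ∈ S := hl' _ (by
    have h1 : x 0 0 * (x 1 2 * x 2 1) - x 0 1 * (x 1 2 * x 2 0) -
        x 0 2 * (x 1 0 * x 2 1 - x 1 1 * x 2 0) ∈ S :=
      sub_mem (sub_mem (mul_mem h00 (mul_mem (h12 h11) (h21 h11)))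
        (mul_mem h01 (mul_mem (h12 h11) h20)))
        (mul_mem h02 (sub_mem (mul_mem h10 (h21 h11)) (mul_mem h11 h20)))
    convert add_mem hd h1 using 1
    simp only [minor]; ring)
  fin_cases i <;> fin_cases j
  exacts [h00, h01, h02, h10, h11, h12 h11, h20, h21 h11, h22]

end Coordinates

/-! ## Linear independence of eigenvectors modulo a prime -/

/-- Dedekind's argument modulo `P`: the operator `T - χ t' • c` kills the term at `t'` and
multiplies the others by `c` times a scalar. As `c ∉ P`, it cancels and leaves a shorter relation.
The factor `c` admits brackets {b, ·} with `c = b` alongside automorphisms with `c = 1`. -/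
theorem eq_zero_of_sum_mem_of_separating {k R τ : Type*} [Field k] [CommRing R] [Algebra k R]
    {P : Ideal R} [hp : P.IsPrime] {v : τ → R} (hv : ∀ t, v t ∉ P)
    (hsep : ∀ t t', t ≠ t' → ∃ (T : R →ₗ[k] R) (c : R) (χ : τ → k), c ∉ P ∧ (∀ a ∈ P, T a ∈ P) ∧
      (∀ s, T (v s) - χ s • (c * v s) ∈ P) ∧ χ t ≠ χ t')
    (f : τ →₀ k) (hf : (f.sum fun t a => a • v t) ∈ P) : f = 0 := by
  classical
  induction hn : f.support.card using Nat.strong_induction_on generalizing f with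
  | _ n ih =>
    by_contra hne
    obtain ⟨t, ht⟩ := Finsupp.support_nonempty_iff.mpr hne
    have ht0 : f t ≠ 0 := Finsupp.mem_support_iff.mp ht
    by_cases hone : ∃ t', t' ∈ f.support ∧ t ≠ t'
    · obtain ⟨t', ht', htt'⟩ := hone
      obtain ⟨T, c, χ, hc, hT, hχ, hneq⟩ := hsep t t' htt'
      let g : τ →₀ k := Finsupp.onFinset (f.support.erase t') (fun s => (χ s - χ t') * f s)
        fun s hs => by
          rw [Finset.mem_erase, Finsupp.mem_support_iff]
          refine ⟨?_, right_ne_zero_of_mul hs⟩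
          rintro rfl
          simp at hs
      have hg : (g.sum fun t a => a • v t) ∈ P := by
        have h1 : c * (g.sum fun t a => a • v t) ∈ P := by
          have h2 := P.sub_mem (hT _ hf) (P.mul_mem_left (χ t' • c) hf)
          have h3 : ∑ s ∈ f.support, f s • (T (v s) - χ s • (c * v s)) ∈ P :=
            P.sum_mem fun s _ => by
              rw [Algebra.smul_def]; exact P.mul_mem_left _ (hχ s)
          convert P.sub_mem h2 h3 using 1
          rw [Finsupp.sum_of_support_subset g (s := f.support)
            (Finsupp.support_onFinset_subset.trans (Finset.erase_subset _ _)) _ (by simp)]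
          simp only [Finsupp.sum, map_sum, map_smul, Finset.mul_sum, ← Finset.sum_sub_distrib]
          refine Finset.sum_congr rfl fun s _ => ?_
          simp only [g, Finsupp.onFinset_apply, Algebra.smul_def, map_mul, map_sub]
          ring
        exact (hp.mem_or_mem h1).resolve_left hc
      have hcard : g.support.card < n := by
        rw [← hn]
        exact (Finset.card_le_card Finsupp.support_onFinset_subset).trans_lt
          (Finset.card_erase_lt_of_mem ht')
      have h0 := DFunLike.congr_fun (ih _ hcard g hg rfl) t
      simp only [g, Finsupp.onFinset_apply, Finsupp.coe_zero, Pi.zero_apply, mul_eq_zero,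
        sub_eq_zero] at h0
      exact h0.elim hneq ht0
    · push Not at hone
      have hsupp : f.support = {t} :=
        Finset.eq_singleton_iff_unique_mem.mpr ⟨ht, fun s hs => (hone s hs).symm⟩
      rw [Finsupp.sum, hsupp, Finset.sum_singleton, Algebra.smul_def] at hf
      have h1 := P.mul_mem_left (algebraMap k R (f t)⁻¹) hf
      rw [← mul_assoc, ← map_mul, inv_mul_cancel₀ ht0, map_one, one_mul] at h1
      exact hv t h1

/-- Log-canonical exponents add along monomials. Only variables that occur need be log-canonical, so
inactive ones may be ignored. -/
theorem derivation_prod_pow_sub_mem {k R ι : Type*} [Field k] [CommRing R] [Algebra k R]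
    (E : Derivation k R R) {P : Ideal R} {c : R} {y : ι → R} {l : ι → ℤ} {n : ι → ℕ}
    (h : ∀ i, n i ≠ 0 → E (y i) - (l i : R) * (c * y i) ∈ P) (s : Finset ι) :
    E (∏ i ∈ s, y i ^ n i) -
      ((∑ i ∈ s, n i * l i : ℤ) : R) * (c * ∏ i ∈ s, y i ^ n i) ∈ P := by
  classical
  induction s using Finset.induction_on with
  | empty => simp
  | insert i s hi ih =>
    have h1 : E (y i ^ n i) - ((n i * l i : ℤ) : R) * (c * y i ^ n i) ∈ P := by
      rcases hni : n i with _ | m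
      · simp
      · have h2 := P.mul_mem_left ((m + 1 : ℕ) * y i ^ m) (h i (by omega))
        convert h2 using 1
        rw [Derivation.leibniz_pow, Nat.add_sub_cancel, smul_eq_mul, nsmul_eq_mul]
        push_cast
        ring
    rw [Finset.prod_insert hi, Finset.sum_insert hi, Derivation.leibniz]
    convert P.add_mem (P.mul_mem_left (y i ^ n i) ih)
      (P.mul_mem_left (∏ i ∈ s, y i ^ n i) h1) using 1
    simp only [smul_eq_mul]
    push_cast
    ring

/-! ## Linear independence of the cluster monomials -/

/-- The weights of the cluster variables under the rows and columns of the torus. -/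
def clusterWeight : Fin 6 → Fin 11 → ℕ :=
  ![![1, 1, 1, 1, 1, 1, 0, 0, 0, 0, 0], ![0, 1, 1, 0, 0, 1, 1, 1, 0, 1, 0],
    ![0, 0, 1, 0, 0, 0, 0, 0, 1, 1, 1], ![1, 1, 1, 0, 0, 0, 0, 1, 1, 1, 0],
    ![0, 1, 1, 1, 0, 1, 0, 0, 0, 1, 1], ![0, 0, 1, 0, 1, 1, 1, 0, 0, 0, 0]]

/-- The cluster variables which do not vanish on the stratum. -/
def clusterActive (c c' : Fin 6) : Finset (Fin 11) := {0, 1, 2} ∪ upperActive c ∪ lowerActive c'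

/-- Exponents of monomials in the active cluster variables. -/
abbrev ClusterExponent (c c' : Fin 6) : Type :=
  {n : Fin 11 → ℕ // ∀ i ∉ clusterActive c c', n i = 0}

/-- The monomials in the active cluster variables. -/
def clusterMonomial {R : Type*} [CommRing R] (x : Fin 3 → Fin 3 → R) (d : R) (c c' : Fin 6)
    (n : ClusterExponent c c') : R := ∏ i, clusterVar x d i ^ n.1 i

/-- Records which exponents vanish on a stratum in a linear form suited to `omega`. -/
theorem upperActive_cases {c c' : Fin 6} (n : ClusterExponent c c') :
    (n.1 6 = 0 ∧ (n.1 5 = 0 ∨ c.1 = 0)) ∧ c.1 < 2 ∨ (n.1 4 = 0 ∧ n.1 5 = 0) ∧ 2 ≤ c.1 := by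
  have h4 := n.2 4
  have h5 := n.2 5
  have h6 := n.2 6
  have key : ∀ c c' : Fin 6, ((6 ∉ clusterActive c c' ∧ (5 ∉ clusterActive c c' ∨ c.1 = 0)) ∧
      c.1 < 2) ∨ ((4 ∉ clusterActive c c' ∧ 5 ∉ clusterActive c c') ∧ 2 ≤ c.1) := by decide
  rcases key c c' with ⟨⟨h, h' | h'⟩, h''⟩ | ⟨⟨h, h'⟩, h''⟩
  · exact .inl ⟨⟨h6 h, .inl (h5 h')⟩, h''⟩
  · exact .inl ⟨⟨h6 h, .inr h'⟩, h''⟩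
  · exact .inr ⟨⟨h4 h, h5 h'⟩, h''⟩

theorem lowerActive_cases {c c' : Fin 6} (n : ClusterExponent c c') :
    (n.1 10 = 0 ∧ (n.1 9 = 0 ∨ c'.1 = 0)) ∧ c'.1 < 2 ∨ (n.1 8 = 0 ∧ n.1 9 = 0) ∧ 2 ≤ c'.1 := by
  have h4 := n.2 8
  have h5 := n.2 9
  have h6 := n.2 10
  have key : ∀ c c' : Fin 6, ((10 ∉ clusterActive c c' ∧ (9 ∉ clusterActive c c' ∨ c'.1 = 0)) ∧
      c'.1 < 2) ∨ ((8 ∉ clusterActive c c' ∧ 9 ∉ clusterActive c c') ∧ 2 ≤ c'.1) := by decide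
  rcases key c c' with ⟨⟨h, h' | h'⟩, h''⟩ | ⟨⟨h, h'⟩, h''⟩
  · exact .inl ⟨⟨h6 h, .inl (h5 h')⟩, h''⟩
  · exact .inl ⟨⟨h6 h, .inr h'⟩, h''⟩
  · exact .inr ⟨⟨h4 h, h5 h'⟩, h''⟩

/-- The joint characters of the torus and of the log-canonical brackets separate the cluster
monomials. -/
theorem clusterExponent_ext {c c' : Fin 6} {m n : ClusterExponent c c'}
    (hw : ∀ s, ∑ i, clusterWeight s i * m.1 i = ∑ i, clusterWeight s i * n.1 i)
    (h0 : ∑ i, m.1 i * (![0, 0, 0, 1, 1, 1, 0, 1, 1, 1, 0] i : ℤ) =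
      ∑ i, n.1 i * (![0, 0, 0, 1, 1, 1, 0, 1, 1, 1, 0] i : ℤ))
    (h1 : ∑ i, m.1 i * (![0, 0, 0, 0, 1, 1, 1, 0, 1, 1, 1] i : ℤ) =
      ∑ i, n.1 i * (![0, 0, 0, 0, 1, 1, 1, 0, 1, 1, 1] i : ℤ))
    (hu : c.1 = 0 → ∑ i, m.1 i * (![-1, 0, 0, 0, 1, 0, 0, 0, 0, 1, 1] i : ℤ) =
      ∑ i, n.1 i * (![-1, 0, 0, 0, 1, 0, 0, 0, 0, 1, 1] i : ℤ))
    (hl : c'.1 = 0 → ∑ i, m.1 i * (![-1, 0, 0, 0, 0, 1, 1, 0, 1, 0, 0] i : ℤ) =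
      ∑ i, n.1 i * (![-1, 0, 0, 0, 0, 1, 1, 0, 1, 0, 0] i : ℤ)) : m = n := by
  have hw0 := hw 0
  have hw1 := hw 1
  have hw2 := hw 2
  have hw3 := hw 3
  have hw4 := hw 4
  have hw5 := hw 5
  have um := upperActive_cases m
  have un := upperActive_cases n
  have lm := lowerActive_cases m
  have ln := lowerActive_cases n
  obtain ⟨m, hm⟩ := m
  obtain ⟨n, hn⟩ := n
  simp only [Subtype.mk.injEq] at *
  clear hw hm hn
  simp [clusterWeight, Fin.sum_univ_succ] at hw0 hw1 hw2 hw3 hw4 hw5 h0 h1 hu hl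
  -- Nine exponents can be nonzero when both strata are open. The torus gives five independent
  -- conditions (row and column degrees have equal sums) and the brackets with x00 and Δ give two;
  -- x01 and x10 supply the last two. On smaller strata, vanishing exponents replace these.
  have hU : (m 6 = n 6 ∧ m 5 = n 5) ∨ (m 6 = n 6 ∧ -(m 0 : ℤ) + (m 4 + (m 9 + m 10)) =
      -(n 0 : ℤ) + (n 4 + (n 9 + n 10))) ∨ (m 4 = n 4 ∧ m 5 = n 5) := by
    clear hw0 hw1 hw2 hw3 hw4 hw5 h0 h1 hl lm ln
    by_cases hc : c.1 = 0
    · exact .inr (.inl ⟨by omega, hu (Fin.ext hc)⟩)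
    · clear hu
      omega
  have hL : (m 10 = n 10 ∧ m 9 = n 9) ∨ (m 10 = n 10 ∧ -(m 0 : ℤ) + (m 5 + (m 6 + m 8)) =
      -(n 0 : ℤ) + (n 5 + (n 6 + n 8))) ∨ (m 8 = n 8 ∧ m 9 = n 9) := by
    clear hw0 hw1 hw2 hw3 hw4 hw5 h0 h1 hu hU um un
    by_cases hc : c'.1 = 0
    · exact .inr (.inl ⟨by omega, hl (Fin.ext hc)⟩)
    · clear hl
      omega
  clear um un lm ln hu hl
  have : ∀ i, m i = n i := by
    rcases hU with ⟨_, _⟩ | ⟨_, _⟩ | ⟨_, _⟩ <;> rcases hL with ⟨_, _⟩ | ⟨_, _⟩ | ⟨_, _⟩ <;>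
    · simp only [Fin.forall_fin_succ]
      simp
      refine ⟨?_, ?_, ?_, ?_, ?_, ?_, ?_, ?_, ?_, ?_, ?_⟩ <;> omega
  exact funext this

namespace IsStdBracket

variable {k R : Type*} [Field k] [CharZero k] [CommRing R] [Algebra k R]
  {D : Derivation k R (Derivation k R R)} {x : Fin 3 → Fin 3 → R} {d : R}

theorem eq_zero_of_clusterMonomial_sum_mem (h : IsStdBracket D x) (hd : ∀ f, D f d = 0)
    {P : Ideal R} [hp : P.IsPrime] (hP : ∀ a ∈ P, ∀ b, D b a ∈ P)
    (ρ : Fin 6 → R →ₐ[k] R) (hρ : ∀ s, ∀ a ∈ P, ρ s a ∈ P)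
    (hw : ∀ s i, ρ s (clusterVar x d i) = (2 : k) ^ clusterWeight s i • clusterVar x d i)
    {c c' : Fin 6} (hu : upperSet x c ⊆ P) (hl : upperSet (fun i j => x j i) c' ⊆ P)
    (hact : ∀ i ∈ clusterActive c c', clusterVar x d i ∉ P) (f : ClusterExponent c c' →₀ k)
    (hf : (f.sum fun n a => a • clusterMonomial x d c c' n) ∈ P) : f = 0 := by
  have hactive : ∀ (n : ClusterExponent c c') i, n.1 i ≠ 0 → i ∈ clusterActive c c' :=
    fun n i hi => by_contra fun hi' => hi (n.2 i hi')
  -- x12 is active only where x02 is a generator, so the exceptional bracket {x00, x12} vanishes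
  -- modulo `P`. The same holds for x21 and x20.
  have h6 : 6 ∈ clusterActive c c' → x 0 2 ∈ P := by
    have : ∀ c c' : Fin 6, 6 ∈ clusterActive c c' → c = 2 ∨ c = 3 := by decide
    intro hm
    apply hu
    rcases this c c' hm with rfl | rfl <;> simp [upperSet]
  have h10 : 10 ∈ clusterActive c c' → x 2 0 ∈ P := by
    have : ∀ c c' : Fin 6, 10 ∈ clusterActive c c' → c' = 2 ∨ c' = 3 := by decide
    intro hm
    apply hl
    rcases this c c' hm with rfl | rfl <;> simp [upperSet]
  have hnot : ∀ b, b ∉ P → ∀ l : Fin 11 → ℤ, (∀ i ∈ clusterActive c c',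
      D b (clusterVar x d i) - (l i : R) * (b * clusterVar x d i) ∈ P) →
      ∀ m n : ClusterExponent c c', ∑ i, m.1 i * l i ≠ ∑ i, n.1 i * l i →
      ∃ (T : R →ₗ[k] R) (c₁ : R) (χ : ClusterExponent c c' → k), c₁ ∉ P ∧ (∀ a ∈ P, T a ∈ P) ∧
      (∀ s, T (clusterMonomial x d c c' s) - χ s • (c₁ * clusterMonomial x d c c' s) ∈ P) ∧
      χ m ≠ χ n := by
    intro b hb l hbl m n hmn
    refine ⟨(D b : R →ₗ[k] R), b, fun n => ((∑ i, n.1 i * l i : ℤ) : k), hb,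
      fun a ha => hP a ha b, fun s => ?_, fun e => hmn (Int.cast_injective e)⟩
    rw [Algebra.smul_def, map_intCast]
    exact derivation_prod_pow_sub_mem (D b) (fun i hi => hbl i (hactive s i hi)) Finset.univ
  refine eq_zero_of_sum_mem_of_separating (fun n hn => ?_) (fun m n hmn => ?_) f hf
  · obtain ⟨i, _, hi⟩ := (hp.prod_mem_iff).mp hn
    by_cases h0 : n.1 i = 0
    · rw [h0, pow_zero] at hi
      exact hp.ne_top ((Ideal.eq_top_iff_one _).mpr hi)
    · exact hact i (hactive n i h0) (hp.mem_of_pow_mem _ hi)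
  · by_contra hcon
    refine hmn (clusterExponent_ext (fun s => ?_) ?_ ?_ (fun hc => ?_) fun hc => ?_)
    · by_contra hs
      refine hcon ⟨(ρ s).toLinearMap, 1, fun n => 2 ^ ∑ i, clusterWeight s i * n.1 i,
        fun h1 => hp.ne_top ((Ideal.eq_top_iff_one _).mpr h1), hρ s, fun t => ?_, fun e => hs ?_⟩
      · rw [one_mul, AlgHom.toLinearMap_apply, clusterMonomial, map_prod]
        simp only [map_pow, hw, smul_pow, ← pow_mul]
        rw [Finset.prod_smul, Finset.prod_pow_eq_pow_sum, sub_self]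
        exact P.zero_mem
      -- Weights are read off from powers of 2, which are distinct in characteristic zero.
      · exact Nat.pow_right_injective le_rfl (by dsimp only at e ⊢; exact_mod_cast e)
    · by_contra hs
      exact hcon (hnot (x 0 0) (hact 0 (by simp [clusterActive])) _ (fun i hi =>
        h.x00_clusterVar hd i (fun e => h6 (e ▸ hi)) fun e => h10 (e ▸ hi)) m n hs)
    · by_contra hs
      refine hcon (hnot (minor x 0 1 0 1) (hact 1 (by simp [clusterActive])) _ (fun i hi => ?_)
        m n hs)
      rw [h.lead_clusterVar hd i, sub_self]
      exact P.zero_mem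
    · obtain rfl : c = 0 := Fin.ext hc
      by_contra hs
      refine hcon (hnot (x 0 1) (hact 3 (by simp [clusterActive, upperActive])) _
        (fun i hi => ?_) m n hs)
      have : ∀ c' : Fin 6, 6 ∉ clusterActive 0 c' := by decide
      rw [h.x01_clusterVar hd i fun e => this c' (e ▸ hi), sub_self]
      exact P.zero_mem
    · obtain rfl : c' = 0 := Fin.ext hc
      by_contra hs
      refine hcon (hnot (x 1 0) (hact 7 (by simp [clusterActive, lowerActive])) _
        (fun i hi => ?_) m n hs)
      have : ∀ c : Fin 6, 10 ∉ clusterActive c 0 := by decide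
      rw [h.x10_clusterVar hd i fun e => this c (e ▸ hi), sub_self]
      exact P.zero_mem

end IsStdBracket

theorem mem_span_clusterMonomial {k R : Type*} [Field k] [CommRing R] [Algebra k R]
    {x : Fin 3 → Fin 3 → R} {d : R} {c c' : Fin 6} {b : R}
    (hb : b ∈ Algebra.adjoin k (clusterVar x d '' clusterActive c c')) :
    b ∈ Submodule.span k (Set.range (clusterMonomial x d c c')) := by
  rw [← Subalgebra.mem_toSubmodule, Algebra.adjoin_eq_span] at hb
  refine Submodule.span_mono ?_ hb
  let S : Submonoid R :=
    { carrier := Set.range (clusterMonomial x d c c')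
      one_mem' := ⟨⟨0, fun _ _ => rfl⟩, by simp [clusterMonomial]⟩
      mul_mem' := by
        rintro _ _ ⟨m, rfl⟩ ⟨n, rfl⟩
        refine ⟨⟨m.1 + n.1, fun i hi => by simp [m.2 i hi, n.2 i hi]⟩, ?_⟩
        simp [clusterMonomial, pow_add, Finset.prod_mul_distrib] }
  refine SetLike.coe_subset_coe.mpr (Submonoid.closure_le (S := S).mpr ?_)
  rintro _ ⟨i, hi, rfl⟩
  refine ⟨⟨Pi.single i 1, fun j hj => Pi.single_eq_of_ne (by rintro rfl; exact hj hi) 1⟩, ?_⟩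
  simp [clusterMonomial, Pi.single_apply, pow_ite]

/-! ## Gauss coordinates -/

/-- The leading principal minors, and the numerators of the entries of the unipotent factors in
the Gauss decomposition. -/
def gaussVar {R : Type*} [CommRing R] (x : Fin 3 → Fin 3 → R) (d : R) : Fin 9 → R :=
  ![x 0 0, minor x 0 1 0 1, d, x 0 1, x 0 2, minor x 0 1 0 2, x 1 0, x 2 0, minor x 0 2 0 1]

/-- The Gauss coordinates which are independent on the stratum. -/
def gaussActive (c c' : Fin 6) : Finset (Fin 9) :=
  {0, 1, 2} ∪ ![{3, 4, 5}, {3, 5}, {3, 5}, {5}, {3}, ∅] c ∪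
    ![{6, 7, 8}, {6, 8}, {6, 8}, {8}, {6}, ∅] c'

section Gauss

variable {k R : Type*} [Field k] [CommRing R] [Algebra k R] {x : Fin 3 → Fin 3 → R} {d : R}
  {S : Subalgebra k R}

/-- On the stratum where x01 x12 - x02 x11 vanishes, x02 is recovered from Δ x02 = x01 (x00 x12 -
x02 x10) - x00 (x01 x12 - x02 x11). -/
theorem upper_mem_of_gauss {c : Fin 6} (hS : upperSet x c ⊆ S)
    (h00 : x 0 0 ∈ S) (h00' : ∀ a, x 0 0 * a ∈ S → a ∈ S)
    (hl : ∀ a, minor x 0 1 0 1 * a ∈ S → a ∈ S)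
    (h3 : c ∈ ({0, 1, 2, 4} : Finset (Fin 6)) → x 0 1 ∈ S) (h4 : c = 0 → x 0 2 ∈ S)
    (h5 : c ∈ ({0, 1, 2, 3} : Finset (Fin 6)) → minor x 0 1 0 2 ∈ S) :
    x 0 1 ∈ S ∧ x 0 2 ∈ S ∧ (x 1 0 ∈ S → x 1 2 ∈ S) := by
  have key : minor x 0 1 0 2 ∈ S → x 0 2 ∈ S → x 1 0 ∈ S → x 1 2 ∈ S := fun h1 h2 h3 =>
    h00' _ (by
      convert add_mem h1 (mul_mem h2 h3) using 1
      simp only [minor]; ring)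
  have key' : minor x 0 1 1 2 ∈ S → x 0 1 ∈ S → minor x 0 1 0 2 ∈ S → x 0 2 ∈ S :=
    fun h1 h2 h3 => hl _ (by
      convert sub_mem (mul_mem h2 h3) (mul_mem h00 h1) using 1
      simp only [minor]; ring)
  fin_cases c <;> simp [upperSet, Set.insert_subset_iff] at hS h3 h4 h5
  · exact ⟨h3, h4, key h5 h4⟩
  · exact ⟨h3, key' hS h3 h5, key h5 (key' hS h3 h5)⟩
  · exact ⟨h3, hS, key h5 hS⟩
  · exact ⟨hS.1, hS.2, key h5 hS.2⟩
  · exact ⟨h3, hS.1, fun _ => hS.2⟩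
  · exact ⟨hS.1, hS.2.1, fun _ => hS.2.2⟩

/-- Gauss coordinates require division by x00 and Δ only, and these are regular modulo every Poisson
ideal. The other cluster variables are not yet known to be regular, so they cannot serve as
denominators in the proof of primality. -/
theorem coord_mem_of_gaussActive {c c' : Fin 6} (hu : upperSet x c ⊆ S)
    (hl : upperSet (fun i j => x j i) c' ⊆ S)
    (hd : d = x 0 0 * minor x 1 2 1 2 - x 0 1 * minor x 1 2 0 2 + x 0 2 * minor x 1 2 0 1)
    (hS : ∀ i ∈ gaussActive c c', gaussVar x d i ∈ S)
    (h0 : ∀ a, x 0 0 * a ∈ S → a ∈ S) (h1 : ∀ a, minor x 0 1 0 1 * a ∈ S → a ∈ S)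
    (i j : Fin 3) : x i j ∈ S := by
  have hmem : ∀ c c' : Fin 6, 0 ∈ gaussActive c c' ∧ 1 ∈ gaussActive c c' ∧
      2 ∈ gaussActive c c' ∧
      (c ∈ ({0, 1, 2, 4} : Finset (Fin 6)) → 3 ∈ gaussActive c c') ∧
      (c = 0 → 4 ∈ gaussActive c c') ∧
      (c ∈ ({0, 1, 2, 3} : Finset (Fin 6)) → 5 ∈ gaussActive c c') ∧
      (c' ∈ ({0, 1, 2, 4} : Finset (Fin 6)) → 6 ∈ gaussActive c c') ∧
      (c' = 0 → 7 ∈ gaussActive c c') ∧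
      (c' ∈ ({0, 1, 2, 3} : Finset (Fin 6)) → 8 ∈ gaussActive c c') := by decide
  obtain ⟨a0, a1, a2, a3, a4, a5, a6, a7, a8⟩ := hmem c c'
  have h00 : x 0 0 ∈ S := hS 0 a0
  have hm : minor (fun i j => x j i) 0 1 0 1 = minor x 0 1 0 1 := by simp only [minor]; ring
  have hm' : minor (fun i j => x j i) 0 1 0 2 = minor x 0 2 0 1 := by simp only [minor]; ring
  obtain ⟨h01, h02, h12⟩ := upper_mem_of_gauss hu h00 h0 h1 (fun h => hS 3 (a3 h))
    (fun h => hS 4 (a4 h)) fun h => hS 5 (a5 h)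
  obtain ⟨h10, h20, h21⟩ := upper_mem_of_gauss hl h00 h0 (by rwa [hm]) (fun h => hS 6 (a6 h))
    (fun h => hS 7 (a7 h)) fun h => hm' ▸ hS 8 (a8 h)
  exact coord_mem_of_gauss h00 (hS 1 a1) (hd ▸ hS 2 a2) h0 h1 h01 h02 (fun _ => h12 h10)
    h10 h20 (fun _ => h21 h01) i j

/-- The values of the Gauss coordinates above the diagonal on a stratum. -/
def stratumVal {F : Type*} [Field F] (c : Fin 6) (e a₁ a₂ a₃ : F) : Fin 3 → F :=
  -- With `e` = Δ, the quotient is the value of x02 that makes x01 x12 - x02 x11 vanish.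
  ![![a₁, a₂, a₃], ![a₁, a₁ * a₃ / e, a₃], ![a₁, 0, a₃], ![0, 0, a₃], ![a₁, 0, 0], 0] c

theorem eq_zero_of_mem_upperSet {F : Type*} [Field F] {y : Fin 3 → Fin 3 → F} {c : Fin 6}
    {a₁ a₂ a₃ : F} (h0 : y 0 0 ≠ 0) (hl : minor y 0 1 0 1 ≠ 0)
    (hy : ![y 0 1, y 0 2, minor y 0 1 0 2] = stratumVal c (minor y 0 1 0 1) a₁ a₂ a₃)
    {g : F} (hg : g ∈ upperSet y c) : g = 0 := by
  have h1 := congrFun hy 0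
  have h2 := congrFun hy 1
  have h3 := congrFun hy 2
  fin_cases c <;> simp [stratumVal, upperSet] at h1 h2 h3 hg
  · rw [hg]
    have e : y 0 0 * minor y 0 1 1 2 = y 0 1 * minor y 0 1 0 2 - minor y 0 1 0 1 * y 0 2 := by
      simp only [minor]; ring
    rw [h1, h2, h3, mul_div_cancel₀ _ hl, sub_self] at e
    exact (mul_eq_zero.mp e).resolve_left h0
  · rw [hg, h2]
  · rcases hg with rfl | rfl <;> assumption
  · rcases hg with rfl | rfl
    · assumption
    · simpa [minor, h2, h0] using h3
  · rcases hg with rfl | rfl | rfl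
    · assumption
    · assumption
    · simpa [minor, h2, h0] using h3

end Gauss

/-- A matrix with given Gauss coordinates. -/
theorem exists_gaussVar_eq {F : Type*} [Field F] {q : Fin 9 → F} (h0 : q 0 ≠ 0) (h1 : q 1 ≠ 0) :
    ∃ y : Fin 3 → Fin 3 → F, gaussVar y
      (y 0 0 * minor y 1 2 1 2 - y 0 1 * minor y 1 2 0 2 + y 0 2 * minor y 1 2 0 1) = q := by
  -- The remaining entries are solved for in turn: row 1 and x21 by dividing by x00, then x22 from
  -- det by dividing by Δ.
  refine ⟨![![q 0, q 3, q 4],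
    ![q 6, (q 1 + q 3 * q 6) / q 0, (q 5 + q 4 * q 6) / q 0],
    ![q 7, (q 8 + q 3 * q 7) / q 0, (q 2 +
      q 0 * ((q 5 + q 4 * q 6) / q 0 * ((q 8 + q 3 * q 7) / q 0)) -
      q 3 * ((q 5 + q 4 * q 6) / q 0 * q 7) -
      q 4 * (q 6 * ((q 8 + q 3 * q 7) / q 0) - (q 1 + q 3 * q 6) / q 0 * q 7)) / q 1]], ?_⟩
  funext i
  fin_cases i <;> simp [gaussVar, minor]
  all_goals (field_simp; ring)

/-! ## The ideals `I_ω` -/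

section OGL3

variable {k : Type*} [Field k]

theorem isStdBracket_bracketDer : IsStdBracket (bracketDer k) (coordMat k) := fun i j l m => by
  rw [bracketDer_coord k (i, j) (l, m), bracketGen, zsmul_eq_mul]

/-- The determinant in `O(GL₃)`. -/
def detGL (k : Type*) [Field k] : OGL3 k := algebraMap (OM3 k) (OGL3 k) (genericDet k)

theorem isUnit_detGL : IsUnit (detGL k) := IsLocalization.Away.algebraMap_isUnit _

theorem detGL_notMem {P : Ideal (OGL3 k)} (hP : P ≠ ⊤) : detGL k ∉ P := fun h =>
  hP (Ideal.eq_top_of_isUnit_mem _ h isUnit_detGL)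

theorem detGL_eq : detGL k = coordMat k 0 0 * minor (coordMat k) 1 2 1 2 -
    coordMat k 0 1 * minor (coordMat k) 1 2 0 2 + coordMat k 0 2 * minor (coordMat k) 1 2 0 1 := by
  simp only [detGL, genericDet, Matrix.det_fin_three, Matrix.mvPolynomialX_apply, map_sub, map_add,
    map_mul, coordMat, Matrix.of_apply, minor]
  ring

theorem bracketDer_detGL (f : OGL3 k) : bracketDer k f (detGL k) = 0 := by
  have : bracketDer k (detGL k) = 0 :=
    derivation_ext_coord k fun a => isStdBracket_bracketDer.det_coord detGL_eq a.1 a.2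
  rw [bracketDer_skew, this, Derivation.zero_apply, neg_zero]

theorem complMinor_two_zero : complMinor k 2 0 = minor (coordMat k) 0 1 1 2 := by
  rw [complMinor, Matrix.det_fin_two]; rfl

theorem complMinor_zero_two : complMinor k 0 2 = minor (fun i j => coordMat k j i) 0 1 1 2 := by
  rw [complMinor, Matrix.det_fin_two, minor, mul_comm (coordMat k 2 0)]; rfl

/-- The index in `upperSet` of the generators of `I_ω` above the diagonal. -/
def upperCode (w : Equiv.Perm (Fin 3)) : Fin 6 :=
  match w 0, w 1, w 2 with
  | 2, 1, 0 => 0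
  | 1, 2, 0 => 1
  | 2, 0, 1 => 2
  | 0, 2, 1 => 3
  | 1, 0, 2 => 4
  | _, _, _ => 5

/-- The index in `upperSet` of the transposes of the generators of `I_ω` below the diagonal. -/
def lowerCode (w : Equiv.Perm (Fin 3)) : Fin 6 :=
  match w 0, w 1, w 2 with
  | 2, 1, 0 => 0
  -- Relative to the upper table, 231 and 312 trade places: below the diagonal the single entry
  -- belongs to 231 and the minor to 312.
  | 1, 2, 0 => 2
  | 2, 0, 1 => 1
  | 0, 2, 1 => 3
  | 1, 0, 2 => 4
  | _, _, _ => 5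

theorem upperCode_bijective : Function.Bijective upperCode := by
  unfold Function.Bijective Function.Injective Function.Surjective; decide

theorem lowerCode_bijective : Function.Bijective lowerCode := by
  unfold Function.Bijective Function.Injective Function.Surjective; decide

theorem upperGens_eq (w : Equiv.Perm (Fin 3)) :
    upperGens k w = upperSet (coordMat k) (upperCode w) := by
  unfold upperGens upperCode
  generalize w 0 = a
  generalize w 1 = b
  generalize w 2 = c
  fin_cases a <;> fin_cases b <;> fin_cases c <;> first | rfl | (rw [complMinor_two_zero]; rfl)

theorem lowerGens_eq (w : Equiv.Perm (Fin 3)) :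
    lowerGens k w = upperSet (fun i j => coordMat k j i) (lowerCode w) := by
  unfold lowerGens lowerCode
  generalize w 0 = a
  generalize w 1 = b
  generalize w 2 = c
  fin_cases a <;> fin_cases b <;> fin_cases c <;> first | rfl | (rw [complMinor_zero_two]; rfl)

/-- The ideals `I_ω`, indexed by the strata above and below the diagonal. -/
def stratumIdeal (k : Type*) [Field k] (c c' : Fin 6) : Ideal (OGL3 k) :=
  Ideal.span (upperSet (fun i j => coordMat k j i) c' ∪ upperSet (coordMat k) c)

theorem idealI_eq (ω : Equiv.Perm (Fin 3) × Equiv.Perm (Fin 3)) :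
    idealI k ω = stratumIdeal k (upperCode ω.2) (lowerCode ω.1) := by
  rw [idealI, stratumIdeal, upperGens_eq, lowerGens_eq]

theorem upperSet_subset_stratumIdeal (c c' : Fin 6) :
    upperSet (coordMat k) c ⊆ stratumIdeal k c c' :=
  Set.subset_union_right.trans Ideal.subset_span

theorem lowerSet_subset_stratumIdeal (c c' : Fin 6) :
    upperSet (fun i j => coordMat k j i) c' ⊆ stratumIdeal k c c' :=
  Set.subset_union_left.trans Ideal.subset_span

/-- Bracketing with `g` modulo `I` is a derivation into the quotient, so it is determined on
coordinates. -/
theorem bracketDer_mem_of_coord {I : Ideal (OGL3 k)} {g : OGL3 k}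
    (h : ∀ i j, bracketDer k g (coordMat k i j) ∈ I) (b : OGL3 k) : bracketDer k g b ∈ I := by
  have : (Submodule.mkQ I).compDer (bracketDer k g) = 0 :=
    derivation_ext_coord k fun a => (Submodule.Quotient.mk_eq_zero I).mpr (h a.1 a.2)
  exact (Submodule.Quotient.mk_eq_zero I).mp (congrArg (fun d => d b) this)

theorem isPoissonIdeal_stratumIdeal [CharZero k] (c c' : Fin 6) :
    IsPoissonIdeal k (stratumIdeal k c c') := by
  rw [stratumIdeal, Ideal.span_union]
  refine .sup (.span fun g hg b => ?_) (.span fun g hg b => ?_)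
  · exact bracketDer_mem_of_coord (fun i j =>
      isStdBracket_bracketDer.transpose.upperSet_coord_mem c' hg j i) b
  · exact bracketDer_mem_of_coord (fun i j =>
      isStdBracket_bracketDer.upperSet_coord_mem c hg i j) b

theorem map_upperSet_mem_span {R : Type*} [CommRing R] [Algebra k R] (φ : R →ₐ[k] R)
    {x : Fin 3 → Fin 3 → R} {α β : Fin 3 → k} (hφ : ∀ i j, φ (x i j) = (α i * β j) • x i j)
    {c : Fin 6} {g : R} (hg : g ∈ upperSet x c) : φ g ∈ Ideal.span (upperSet x c) := by
  have key : ∃ r : k, φ g = r • g := by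
    fin_cases c <;> simp [upperSet] at hg
    · refine ⟨α 0 * α 1 * β 1 * β 2, ?_⟩
      rw [hg]
      simp only [minor, map_sub, map_mul, hφ, Algebra.smul_def]
      ring
    · exact hg ▸ ⟨_, hφ _ _⟩
    · rcases hg with rfl | rfl <;> exact ⟨_, hφ _ _⟩
    · rcases hg with rfl | rfl <;> exact ⟨_, hφ _ _⟩
    · rcases hg with rfl | rfl | rfl <;> exact ⟨_, hφ _ _⟩
  obtain ⟨r, hr⟩ := key
  rw [hr, Algebra.smul_def]
  exact Ideal.mul_mem_left _ _ (Ideal.subset_span hg)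

theorem torusAction_coordMat (h : Torus k) (i j : Fin 3) :
    torusAction k h (coordMat k i j) = ((h.1 i : k) * (h.2 j : k)) • coordMat k i j :=
  torusEnd_coord k h i j

theorem torusAction_detGL (h : Torus k) : torusAction k h (detGL k) =
    ((h.1 0 * h.1 1 * h.1 2 : k) * (h.2 0 * h.2 1 * h.2 2 : k)) • detGL k := by
  rw [detGL_eq]
  simp only [minor, map_sub, map_add, map_mul, torusAction_coordMat, Algebra.smul_def]
  ring

theorem isHStable_stratumIdeal (c c' : Fin 6) :
    IsHStable (torusAction k) (stratumIdeal k c c') := by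
  rw [stratumIdeal, Ideal.span_union]
  have key : ∀ s : Set (OGL3 k), (∀ h, ∀ g ∈ s, torusAction k h g ∈ Ideal.span s) →
      IsHStable (torusAction k) (Ideal.span s) := fun s hs => isHStable_iff.mpr fun h a ha =>
    (Ideal.span_le (I := Ideal.comap (torusAction k h) (Ideal.span s))).mpr (hs h) ha
  refine .sup (key _ fun h g hg => ?_) (key _ fun h g hg => ?_)
  · exact map_upperSet_mem_span (torusAction k h : OGL3 k →ₐ[k] OGL3 k)
      (α := fun i => (h.2 i : k)) (β := fun i => (h.1 i : k))
      (fun i j => by rw [mul_comm]; exact torusAction_coordMat h j i) hg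
  · exact map_upperSet_mem_span (torusAction k h : OGL3 k →ₐ[k] OGL3 k)
      (torusAction_coordMat h) hg

end OGL3

/-! ## Primality of the ideals `I_ω` -/

section

variable {k : Type*} [Field k]

theorem exists_algHom_coordMat {F : Type*} [Field F] [Algebra k F] (y : Fin 3 → Fin 3 → F)
    (hy : y 0 0 * minor y 1 2 1 2 - y 0 1 * minor y 1 2 0 2 + y 0 2 * minor y 1 2 0 1 ≠ 0) :
    ∃ φ : OGL3 k →ₐ[k] F, ∀ i j, φ (coordMat k i j) = y i j := by
  let ψ : OM3 k →ₐ[k] F := aeval fun a => y a.1 a.2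
  have hψ : IsUnit (ψ (genericDet k)) := by
    rw [isUnit_iff_ne_zero]
    convert hy using 1
    simp only [ψ, genericDet, Matrix.det_fin_three, Matrix.mvPolynomialX_apply, map_sub, map_add,
      map_mul, aeval_X, minor]
    ring
  refine ⟨IsLocalization.Away.liftAlgHom (genericDet k) hψ, fun i j => ?_⟩
  have e : IsLocalization.Away.liftAlgHom (genericDet k) hψ (coordMat k i j) = ψ (X (i, j)) :=
    IsLocalization.Away.lift_eq (genericDet k) hψ _
  rw [e]
  exact aeval_X _ _

theorem image_upperSet {R F : Type*} [CommRing R] [CommRing F] (φ : R →+* F)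
    (x : Fin 3 → Fin 3 → R) (c : Fin 6) :
    φ '' upperSet x c = upperSet (fun i j => φ (x i j)) c := by
  fin_cases c <;> simp [upperSet, minor, Set.image_insert_eq]

/-- A point of the stratum with given Gauss coordinates, over an extension field. -/
theorem exists_algHom_stratum {F : Type*} [Field F] [Algebra k F] (c c' : Fin 6) (t : Fin 9 → F)
    (h0 : t 0 ≠ 0) (h1 : t 1 ≠ 0) (h2 : t 2 ≠ 0) :
    ∃ φ : OGL3 k →ₐ[k] F, stratumIdeal k c c' ≤ RingHom.ker φ ∧
      ∀ i, φ (gaussVar (coordMat k) (detGL k) i) =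
        Fin.append ![t 0, t 1, t 2] (Fin.append (stratumVal c (t 1) (t 3) (t 4) (t 5))
          (stratumVal c' (t 1) (t 6) (t 7) (t 8))) i := by
  obtain ⟨y, hy⟩ := exists_gaussVar_eq (q := Fin.append ![t 0, t 1, t 2]
    (Fin.append (stratumVal c (t 1) (t 3) (t 4) (t 5))
      (stratumVal c' (t 1) (t 6) (t 7) (t 8)))) h0 h1
  have hy0 : y 0 0 = t 0 := congrFun hy 0
  have hy1 : minor y 0 1 0 1 = t 1 := congrFun hy 1
  have hy2 := congrFun hy 2
  obtain ⟨φ, hφ⟩ := exists_algHom_coordMat (k := k) y (by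
    refine ne_of_eq_of_ne ?_ h2
    exact hy2)
  refine ⟨φ, Ideal.span_le.mpr ?_, fun i => ?_⟩
  · rintro g (hg | hg)
    · refine eq_zero_of_mem_upperSet (y := fun i j => φ (coordMat k j i)) (c := c')
        (a₁ := t 6) (a₂ := t 7) (a₃ := t 8) ?_ ?_ ?_ (image_upperSet φ.toRingHom _ _ ▸ ⟨g, hg, rfl⟩)
      · rw [hφ, hy0]; exact h0
      · convert h1 using 1; rw [← hy1]; simp only [minor, hφ]; ring
      · have hm : minor (fun i j => φ (coordMat k j i)) 0 1 0 1 = t 1 := by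
          rw [← hy1]; simp only [minor, hφ]; ring
        have hm' : minor (fun i j => φ (coordMat k j i)) 0 1 0 2 = minor y 0 2 0 1 := by
          simp only [minor, hφ]; ring
        rw [hm, hm', hφ, hφ]
        funext i
        fin_cases i
        · exact congrFun hy 6
        · exact congrFun hy 7
        · exact congrFun hy 8
    · refine eq_zero_of_mem_upperSet (y := fun i j => φ (coordMat k i j)) (c := c)
        (a₁ := t 3) (a₂ := t 4) (a₃ := t 5) ?_ ?_ ?_ (image_upperSet φ.toRingHom _ _ ▸ ⟨g, hg, rfl⟩)
      · rw [hφ, hy0]; exact h0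
      · convert h1 using 1; rw [← hy1]; simp only [minor, hφ]
      · have hm : minor (fun i j => φ (coordMat k i j)) 0 1 0 1 = t 1 := by
          rw [← hy1]; simp only [minor, hφ]
        have hm' : minor (fun i j => φ (coordMat k i j)) 0 1 0 2 = minor y 0 1 0 2 := by
          simp only [minor, hφ]
        rw [hm, hm', hφ, hφ]
        funext i
        fin_cases i
        · exact congrFun hy 3
        · exact congrFun hy 4
        · exact congrFun hy 5
  · rw [← hy, detGL_eq]
    fin_cases i <;> simp [gaussVar, minor, hφ]

theorem subalgebra_eq_top_of_coordMat_mem {S : Subalgebra k (OGL3 k)}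
    (h : ∀ i j, coordMat k i j ∈ S) (hd : ∀ a, detGL k * a ∈ S → a ∈ S) : S = ⊤ := by
  have hpoly : ∀ f : OM3 k, algebraMap (OM3 k) (OGL3 k) f ∈ S := by
    intro f
    induction f using MvPolynomial.induction_on with
    | C a =>
      rw [← MvPolynomial.algebraMap_eq, ← IsScalarTower.algebraMap_apply]
      exact S.algebraMap_mem a
    | add p q hp hq => rw [map_add]; exact add_mem hp hq
    | mul_X p a hp => rw [map_mul]; exact mul_mem hp (h a.1 a.2)
  have hpow : ∀ (n : ℕ) a, detGL k ^ n * a ∈ S → a ∈ S := by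
    intro n
    induction n with
    | zero => intro a ha; simpa using ha
    | succ n ih => intro a ha; exact hd _ (ih _ (by rwa [pow_succ, mul_assoc] at ha))
  refine Algebra.eq_top_iff.mpr fun a => ?_
  obtain ⟨f, ⟨_, n, rfl⟩, rfl⟩ := IsLocalization.exists_mk'_eq (Submonoid.powers (genericDet k)) a
  refine hpow n _ ?_
  have e := IsLocalization.mk'_spec' (OGL3 k) f
    (⟨_, n, rfl⟩ : Submonoid.powers (genericDet k))
  rw [map_pow] at e
  exact e ▸ hpoly f

variable [CharZero k]

theorem mem_of_two_mul_mem {R : Type*} [CommRing R] [Algebra k R] {J : Ideal R} {a : R}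
    (h : 2 * a ∈ J) : a ∈ J := by
  have h1 := J.mul_mem_left (algebraMap k R (2 : k)⁻¹) h
  rwa [← mul_assoc, ← map_ofNat (algebraMap k R), ← map_mul, inv_mul_cancel₀ two_ne_zero, map_one,
    one_mul] at h1

theorem span_insert_poissonDer_eq_top (c : OGL3 k) (H : ∀ J : Ideal (OGL3 k), c ∈ J →
    (∀ b, bracketDer k c b ∈ J) → ∃ n : ℕ, detGL k ^ n ∈ J) :
    Ideal.span (insert c (Set.range fun b => poissonDer k b c)) = ⊤ := by
  obtain ⟨n, hn⟩ := H (Ideal.span (insert c (Set.range fun b => poissonDer k b c)))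
    (Ideal.subset_span (Set.mem_insert _ _)) fun b => by
      rw [bracketDer_skew, neg_mem_iff]
      exact Ideal.subset_span (Set.mem_insert_of_mem _ ⟨b, rfl⟩)
  exact Ideal.eq_top_of_isUnit_mem _ hn (isUnit_detGL.pow n)

theorem span_insert_x00 :
    Ideal.span (insert (coordMat k 0 0) (Set.range fun b => poissonDer k b (coordMat k 0 0))) =
      ⊤ :=
  span_insert_poissonDer_eq_top _ fun J h hJ => ⟨1, by
    rw [pow_one, detGL_eq]
    exact isStdBracket_bracketDer.det_mem_of_x00_mem
      (fun a => mem_of_two_mul_mem (k := k)) h hJ⟩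

theorem span_insert_lead :
    Ideal.span (insert (minor (coordMat k) 0 1 0 1)
      (Set.range fun b => poissonDer k b (minor (coordMat k) 0 1 0 1))) = ⊤ :=
  span_insert_poissonDer_eq_top _ fun J h hJ => ⟨2, by
    rw [detGL_eq]
    exact isStdBracket_bracketDer.det_sq_mem_of_lead_mem
      (fun a => mem_of_two_mul_mem (k := k)) h hJ⟩

instance isNoetherianRing_OGL3 : IsNoetherianRing (OGL3 k) :=
  IsLocalization.isNoetherianRing (Submonoid.powers (genericDet k)) _ inferInstance

/-- The leading principal minors are regular modulo every Poisson ideal. -/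
theorem IsPoissonIdeal.mem_of_leading_mul_mem {I : Ideal (OGL3 k)} (hI : IsPoissonIdeal k I)
    {μ : OGL3 k} (hμ : μ ∈ Submonoid.closure
      {coordMat k 0 0, minor (coordMat k) 0 1 0 1, detGL k}) :
    ∀ a, μ * a ∈ I → a ∈ I := by
  refine Submonoid.closure_induction (fun x hx a ha => ?_) (fun a ha => by simpa using ha)
    (fun x y _ _ hx hy a ha => hy a (hx _ (by rwa [mul_assoc] at ha))) hμ
  rcases hx with rfl | rfl | rfl
  · exact hI.mem_of_mul_mem span_insert_x00 ha
  · exact hI.mem_of_mul_mem span_insert_lead ha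
  · exact (Ideal.unit_mul_mem_iff_mem I isUnit_detGL).mp ha

theorem isPrime_stratumIdeal (c c' : Fin 6) : (stratumIdeal k c c').IsPrime := by
  -- The generic point has nine independent parameters. The stratum fixes some Gauss coordinates;
  -- the active ones are sent to distinct variables.
  let F := FractionRing (MvPolynomial (Fin 9) k)
  have hinj : Function.Injective (algebraMap (MvPolynomial (Fin 9) k) F) :=
    IsFractionRing.injective _ _
  let t : Fin 9 → F := fun i => algebraMap (MvPolynomial (Fin 9) k) F (X i)
  have ht : ∀ i, t i ≠ 0 := fun i h =>
    X_ne_zero (R := k) i (hinj (by rw [map_zero]; exact h))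
  have htind : AlgebraicIndependent k t :=
    (MvPolynomial.algebraicIndependent_X (Fin 9) k).map' (f := IsScalarTower.toAlgHom k _ F) hinj
  obtain ⟨φ, hker, hφ⟩ := exists_algHom_stratum (k := k) c c' t (ht 0) (ht 1) (ht 2)
  have hz : AlgebraicIndependent k
      (φ ∘ fun i : gaussActive c c' => gaussVar (coordMat k) (detGL k) i) := by
    convert htind.comp (fun i : gaussActive c c' => (i : Fin 9)) Subtype.val_injective using 1
    funext ⟨i, hi⟩
    rw [Function.comp_apply, hφ, Function.comp_apply]
    clear hφ hker htind
    generalize t = t at *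
    revert hi
    fin_cases i
    · exact fun _ => rfl
    · exact fun _ => rfl
    · exact fun _ => rfl
    · fin_cases c <;> intro hi <;> first | rfl | (exfalso; revert hi; revert c'; decide)
    · fin_cases c <;> intro hi <;> first | rfl | (exfalso; revert hi; revert c'; decide)
    · fin_cases c <;> intro hi <;> first | rfl | (exfalso; revert hi; revert c'; decide)
    · fin_cases c' <;> intro hi <;> first | rfl | (exfalso; revert hi; revert c; decide)
    · fin_cases c' <;> intro hi <;> first | rfl | (exfalso; revert hi; revert c; decide)
    · fin_cases c' <;> intro hi <;> first | rfl | (exfalso; revert hi; revert c; decide)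
  have htop : fractionSubalgebra (stratumIdeal k c c') (Algebra.adjoin k
      (Set.range fun i : gaussActive c c' => gaussVar (coordMat k) (detGL k) i))
      (Submonoid.closure {coordMat k 0 0, minor (coordMat k) 0 1 0 1, detGL k}) = ⊤ := by
    have hA : ∀ i ∈ gaussActive c c', gaussVar (coordMat k) (detGL k) i ∈ Algebra.adjoin k
        (Set.range fun i : gaussActive c c' => gaussVar (coordMat k) (detGL k) i) :=
      fun i hi => Algebra.subset_adjoin ⟨⟨i, hi⟩, rfl⟩
    refine subalgebra_eq_top_of_coordMat_mem (coord_mem_of_gaussActive (c := c) (c' := c')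
      (d := detGL k)
      (fun g hg => mem_fractionSubalgebra_of_mem_ideal (upperSet_subset_stratumIdeal c c' hg))
      (fun g hg => mem_fractionSubalgebra_of_mem_ideal (lowerSet_subset_stratumIdeal c c' hg))
      detGL_eq (fun i hi => mem_fractionSubalgebra_of_mem (hA i hi)) ?_ ?_) ?_
    · exact fun a ha => mem_fractionSubalgebra_of_mul_mem (Submonoid.subset_closure (.inl rfl))
        (hA 0 (by simp [gaussActive])) ha
    · exact fun a ha => mem_fractionSubalgebra_of_mul_mem (Submonoid.subset_closure (.inr (.inl rfl)))
        (hA 1 (by simp [gaussActive])) ha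
    · exact fun a ha => mem_fractionSubalgebra_of_mul_mem (Submonoid.subset_closure (.inr (.inr rfl)))
        (hA 2 (by simp [gaussActive])) ha
  rw [← ker_eq_of_fractionSubalgebra_eq_top φ hker hz htop fun μ hμ =>
    (isPoissonIdeal_stratumIdeal c c').mem_of_leading_mul_mem hμ]
  exact RingHom.ker_isPrime _

end

/-! ## The ideals `I_ω` are distinct -/

/-- `stratumOrder e` consists of the strata in the closure of the stratum `e`. -/
def stratumOrder : Fin 6 → Finset (Fin 6) :=
  ![Finset.univ, {1, 3, 4, 5}, {2, 3, 4, 5}, {3, 5}, {4, 5}, {5}]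

theorem stratumOrder_antisymm {c e : Fin 6} (h : c ∈ stratumOrder e) (h' : e ∈ stratumOrder c) :
    c = e := by
  revert c e; decide

/-- One test point per stratum `c`: it satisfies the equations of `e` only if `c` lies in the
closure of `e`. -/
theorem mem_stratumOrder {F : Type*} [Field F] [CharZero F] {y : Fin 3 → Fin 3 → F} {c e : Fin 6}
    (h0 : y 0 0 = 1) (h1 : minor y 0 1 0 1 = 1) (h01 : y 0 1 = stratumVal c 1 1 2 1 0)
    (h02 : y 0 2 = stratumVal c 1 1 2 1 1) (hU : minor y 0 1 0 2 = stratumVal c 1 1 2 1 2)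
    (h : ∀ g ∈ upperSet y e, g = 0) : c ∈ stratumOrder e := by
  have hm : minor y 0 1 1 2 = y 0 1 * minor y 0 1 0 2 - minor y 0 1 0 1 * y 0 2 := by
    have : minor y 0 1 1 2 = y 0 0 * minor y 0 1 1 2 := by rw [h0, one_mul]
    rw [this]; simp only [minor]; ring
  have h12 : y 1 2 = minor y 0 1 0 2 + y 0 2 * y 1 0 := by
    have : y 1 2 = y 0 0 * y 1 2 := by rw [h0, one_mul]
    rw [this]; simp only [minor]; ring
  fin_cases e <;> simp only [upperSet] at h <;> fin_cases c <;> first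
    | decide
    | (exfalso
       simp [stratumVal] at h01 h02 hU
       simp [hm, h12, h01, h02, hU, h1] at h
       try norm_num at h)

theorem eq_of_stratumIdeal_le {k : Type*} [Field k] [CharZero k] {c c' e e' : Fin 6}
    (h : stratumIdeal k e e' ≤ stratumIdeal k c c') : c ∈ stratumOrder e ∧ c' ∈ stratumOrder e' := by
  -- The value 2 differs from a₁a₃/Δ = 1, so x01 x12 - x02 x11 is nonzero on the open stratum.
  obtain ⟨φ, hker, hφ⟩ := exists_algHom_stratum (k := k) (F := k) c c' ![1, 1, 1, 1, 2, 1, 1, 2, 1]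
    one_ne_zero one_ne_zero one_ne_zero
  have hm : ∀ i l j m, φ (minor (coordMat k) i l j m) =
      minor (fun i j => φ (coordMat k i j)) i l j m := fun i l j m => by simp [minor]
  have hm' : ∀ i l j m, φ (minor (coordMat k) i l j m) =
      minor (fun i j => φ (coordMat k j i)) j m i l := fun i l j m => by simp [minor]; ring
  constructor
  · refine mem_stratumOrder (y := fun i j => φ (coordMat k i j)) (hφ 0)
      ((hm _ _ _ _).symm.trans (hφ 1)) (hφ 3) (hφ 4) ((hm _ _ _ _).symm.trans (hφ 5)) fun g hg => ?_
    obtain ⟨g, hg', rfl⟩ := (image_upperSet φ.toRingHom (coordMat k) e).ge hg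
    exact hker (h (upperSet_subset_stratumIdeal e e' hg'))
  · refine mem_stratumOrder (y := fun i j => φ (coordMat k j i)) (hφ 0)
      ((hm' _ _ _ _).symm.trans (hφ 1)) (hφ 6) (hφ 7) ((hm' _ _ _ _).symm.trans (hφ 8))
      fun g hg => ?_
    obtain ⟨g, hg', rfl⟩ := (image_upperSet φ.toRingHom (fun i j => coordMat k j i) e').ge hg
    exact hker (h (lowerSet_subset_stratumIdeal e e' hg'))

/-! ## Classification of the Poisson `H`-primes -/

section

variable {k : Type*} [Field k]

/-- The one-parameter rows and columns of the torus, at the value `2`. -/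
def torusTwo (k : Type*) [Field k] [CharZero k] : Fin 6 → Torus k :=
  let u : kˣ := Units.mk0 2 two_ne_zero
  ![(![u, 1, 1], 1), (![1, u, 1], 1), (![1, 1, u], 1),
    (1, ![u, 1, 1]), (1, ![1, u, 1]), (1, ![1, 1, u])]

theorem torusAction_clusterVar (h : Torus k) (i : Fin 11) :
    torusAction k h (clusterVar (coordMat k) (detGL k) i) =
      ((![h.1 0 * h.2 0, h.1 0 * h.1 1 * (h.2 0 * h.2 1),
        h.1 0 * h.1 1 * h.1 2 * (h.2 0 * h.2 1 * h.2 2),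
        h.1 0 * h.2 1, h.1 0 * h.2 2, h.1 0 * h.1 1 * (h.2 1 * h.2 2), h.1 1 * h.2 2,
        h.1 1 * h.2 0, h.1 2 * h.2 0, h.1 1 * h.1 2 * (h.2 0 * h.2 1), h.1 2 * h.2 1] i : kˣ) : k) •
        clusterVar (coordMat k) (detGL k) i := by
  have hminor : ∀ i l j m, torusAction k h (minor (coordMat k) i l j m) =
      (((h.1 i * h.1 l * (h.2 j * h.2 m) : kˣ)) : k) • minor (coordMat k) i l j m := by
    intro i l j m
    simp only [minor, map_sub, map_mul, torusAction_coordMat, Algebra.smul_def, Units.val_mul]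
    ring
  match i with
  | 1 | 5 | 9 => exact hminor _ _ _ _
  | 2 => exact (torusAction_detGL h).trans (by simp [clusterVar])
  | 0 | 3 | 4 | 6 | 7 | 8 | 10 =>
    exact (torusAction_coordMat h _ _).trans (by simp [clusterVar])

/-- Divisibility of the torus, the one place where algebraic closedness enters. -/
theorem exists_torus_pow_eq [IsAlgClosed k] (n : ℕ) (hn : 0 < n) (h : Torus k) :
    ∃ g : Torus k, g ^ n = h := by
  have key : ∀ u : kˣ, ∃ v : kˣ, v ^ n = u := fun u => by
    obtain ⟨z, hz⟩ := IsAlgClosed.exists_pow_nat_eq (u : k) hn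
    have hz0 : z ≠ 0 := by
      rintro rfl
      rw [zero_pow hn.ne'] at hz
      exact u.ne_zero hz.symm
    exact ⟨Units.mk0 z hz0, Units.ext (by simpa using hz)⟩
  choose f hf using key
  exact ⟨(fun i => f (h.1 i), fun i => f (h.2 i)),
    Prod.ext (funext fun i => hf _) (funext fun i => hf _)⟩

theorem torusTwo_clusterVar [CharZero k] (s : Fin 6) (i : Fin 11) :
    torusAction k (torusTwo k s) (clusterVar (coordMat k) (detGL k) i) =
      (2 : k) ^ clusterWeight s i • clusterVar (coordMat k) (detGL k) i := by
  rw [torusAction_clusterVar]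
  congr 1
  fin_cases s <;> fin_cases i <;> simp [torusTwo, clusterWeight]

theorem fractionSubalgebra_cluster_eq_top (c c' : Fin 6) :
    fractionSubalgebra (stratumIdeal k c c')
      (Algebra.adjoin k (clusterVar (coordMat k) (detGL k) '' clusterActive c c'))
      (Submonoid.closure (clusterVar (coordMat k) (detGL k) '' clusterActive c c')) = ⊤ := by
  set S := fractionSubalgebra (stratumIdeal k c c')
    (Algebra.adjoin k (clusterVar (coordMat k) (detGL k) '' clusterActive c c'))
    (Submonoid.closure (clusterVar (coordMat k) (detGL k) '' clusterActive c c')) with hS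
  have hact : ∀ i ∈ clusterActive c c', clusterVar (coordMat k) (detGL k) i ∈ S ∧
      ∀ a, clusterVar (coordMat k) (detGL k) i * a ∈ S → a ∈ S := fun i hi =>
    ⟨mem_fractionSubalgebra_of_mem (Algebra.subset_adjoin ⟨i, hi, rfl⟩), fun a ha =>
      mem_fractionSubalgebra_of_mul_mem (Submonoid.subset_closure ⟨i, hi, rfl⟩)
        (Algebra.subset_adjoin ⟨i, hi, rfl⟩) ha⟩
  have h0 := hact 0 (by simp [clusterActive])
  have h1 := hact 1 (by simp [clusterActive])
  have h2 := hact 2 (by simp [clusterActive])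
  obtain ⟨h01, h02, h12⟩ := upper_mem_of_upperActive (S := S) (c := c) (x := coordMat k)
    (d := detGL k)
    (fun g hg => mem_fractionSubalgebra_of_mem_ideal (upperSet_subset_stratumIdeal c c' hg))
    fun i hi => hact i (by simp [clusterActive, hi])
  obtain ⟨h10, h20, h21⟩ := lower_mem_of_lowerActive (S := S) (c := c') (x := coordMat k)
    (d := detGL k)
    (fun g hg => mem_fractionSubalgebra_of_mem_ideal (lowerSet_subset_stratumIdeal c c' hg))
    fun i hi => hact i (by simp [clusterActive, hi])
  exact subalgebra_eq_top_of_coordMat_mem (coord_mem_of_gauss h0.1 h1.1 (detGL_eq (k := k) ▸ h2.1)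
    h0.2 h1.2 h01 h02 h12 h10 h20 h21) h2.2

variable [CharZero k]

theorem eq_stratumIdeal_of_isPoissonHPrime [IsAlgClosed k] {P : Ideal (OGL3 k)}
    (hP : IsPoissonHPrime (torusAction k) P) : ∃ c c', P = stratumIdeal k c c' := by
  have hp : P.IsPrime := hP.isPrime exists_torus_pow_eq
  have hbr : ∀ a ∈ P, ∀ b, bracketDer k a b ∈ P := hP.poisson
  have h2 : ∀ a : OGL3 k, 2 * a ∈ P → a ∈ P := fun _ h => mem_of_two_mul_mem (k := k) h
  have hd : detGL k ∉ P := detGL_notMem hp.ne_top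
  have h0 : coordMat k 0 0 ∉ P := fun h => hd (by
    rw [detGL_eq]
    exact isStdBracket_bracketDer.det_mem_of_x00_mem h2 h (hbr _ h))
  have h1 : minor (coordMat k) 0 1 0 1 ∉ P := fun h => hd (by
    rw [detGL_eq]
    exact hp.mem_of_pow_mem 2 (isStdBracket_bracketDer.det_sq_mem_of_lead_mem h2 h (hbr _ h)))
  obtain ⟨c, hu, hua⟩ := isStdBracket_bracketDer.exists_upper h2 hbr (detGL_eq (k := k) ▸ hd)
    (detGL k)
  obtain ⟨c', hl, hla⟩ := isStdBracket_bracketDer.exists_lower h2 hbr (detGL_eq (k := k) ▸ hd)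
    (detGL k)
  have hact : ∀ i ∈ clusterActive c c', clusterVar (coordMat k) (detGL k) i ∉ P := by
    intro i hi
    simp only [clusterActive, Finset.mem_union, Finset.mem_insert, Finset.mem_singleton] at hi
    rcases hi with ((rfl | rfl | rfl) | hi) | hi
    exacts [h0, h1, hd, hua i hi, hla i hi]
  have hle : stratumIdeal k c c' ≤ P := Ideal.span_le.mpr (Set.union_subset hl hu)
  refine ⟨c, c', le_antisymm ?_ hle⟩
  -- Denominators are products of active variables, hence outside `P` and so outside the smaller
  -- ideal; primality of the latter lets them be cancelled.
  refine le_of_fractionSubalgebra_eq_top (isPrime_stratumIdeal c c') hle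
    (fun b hb => mem_span_clusterMonomial hb) (fun f hf => ?_)
    (fractionSubalgebra_cluster_eq_top c c') fun μ hμ hμI => ?_
  · exact isStdBracket_bracketDer.eq_zero_of_clusterMonomial_sum_mem bracketDer_detGL
      (fun a ha b => by rw [bracketDer_skew, neg_mem_iff]; exact hbr a ha b)
      (fun s => (torusAction k (torusTwo k s) : OGL3 k →ₐ[k] OGL3 k))
      (fun s => isHStable_iff.mp hP.stable _) torusTwo_clusterVar hu hl hact f hf
  · have : Submonoid.closure (clusterVar (coordMat k) (detGL k) '' clusterActive c c') ≤
        P.primeCompl := by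
      rw [Submonoid.closure_le]
      rintro _ ⟨i, hi, rfl⟩
      exact hact i hi
    exact this hμ (hle hμI)

theorem isPoissonHPrime_stratumIdeal (c c' : Fin 6) :
    IsPoissonHPrime (torusAction k) (stratumIdeal k c c') where
  ne_top := (isPrime_stratumIdeal c c').ne_top
  poisson := isPoissonIdeal_stratumIdeal c c'
  stable := isHStable_stratumIdeal c c'
  le_or_le _ _ _ _ _ _ h := (isPrime_stratumIdeal c c').mul_le.mp h

theorem idealI_injective : Function.Injective (idealI k) := by
  intro ω ω' h
  rw [idealI_eq, idealI_eq] at h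
  obtain ⟨h1, h2⟩ := eq_of_stratumIdeal_le h.le
  obtain ⟨h3, h4⟩ := eq_of_stratumIdeal_le h.ge
  exact Prod.ext (lowerCode_bijective.1 (stratumOrder_antisymm h4 h2))
    (upperCode_bijective.1 (stratumOrder_antisymm h3 h1))

end

end

theorem theorem5p3p13 (k : Type*) [Field k] [IsAlgClosed k] [CharZero k] :
    {P : Ideal (OGL3 k) | IsPoissonHPrime (torusAction k) P} = Set.range (idealI k) ∧
    {P : Ideal (OGL3 k) | IsPoissonHPrime (torusAction k) P}.ncard = 36 ∧
    (∀ ω : Equiv.Perm (Fin 3) × Equiv.Perm (Fin 3), (idealI k ω).IsPrime) := by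
  have hrange : {P : Ideal (OGL3 k) | IsPoissonHPrime (torusAction k) P} =
      Set.range (idealI k) := by
    ext P
    constructor
    · intro hP
      obtain ⟨c, c', rfl⟩ := eq_stratumIdeal_of_isPoissonHPrime hP
      obtain ⟨w, rfl⟩ := upperCode_bijective.2 c
      obtain ⟨w', rfl⟩ := lowerCode_bijective.2 c'
      exact ⟨(w', w), idealI_eq _⟩
    · rintro ⟨ω, rfl⟩
      rw [idealI_eq]
      exact isPoissonHPrime_stratumIdeal _ _
  refine ⟨hrange, ?_, fun ω => ?_⟩
  · rw [hrange, ← Set.image_univ, Set.ncard_image_of_injective _ idealI_injective, Set.ncard_univ,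
      Nat.card_eq_fintype_card, Fintype.card_prod, Fintype.card_perm, Fintype.card_fin]
    rfl
  · rw [idealI_eq]
    exact isPrime_stratumIdeal _ _
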